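/- Let $f:\mathbb{R}^d\to\mathbb{R}$ be locally Lipschitz, and suppose that it is subdifferentially polynomially bounded with parameters ${\rm R}_1>0$, ${\rm R}_2>0$ and an integer $m\ge 1$, i.e. $\|\zeta\|\le {\rm R}_1\|x\|^m+{\rm R}_2$ for all $x\in\mathbb{R}^d$ and all $\zeta$ in the Clarke subdifferential $\partial_C f(x)=\{s:\langle s,v\rangle\le \limsup_{x'\to x,\,t\downarrow0}\frac{f(x'+tv)-f(x')}{t}\ \forall v\in\mathbb{R}^d\}$. Assume that $f$ is convex and level-bounded, i.e. $\{x\in\mathbb{R}^d: f(x)\le\alpha\}$ is bounded for every $\alpha\in\mathbb{R}$. Let $\Omega\subseteq\mathbb{R}^d$ be a closed convex set, $P_\Omega$ the projection onto it, and $x^*$ a minimizer of $f$ over $\Omega$. Let $\sigma>0$, $x^0\in\Omega$, $\{\tau_k\}_{k\ge0}\subset(0,1]$, let $u^0,u^1,\dots$ be independent standard Gaussian vectors in $\mathbb{R}^d$, and let $\{x^k\}$ be generated by $$v^k=\frac1\sigma\big[f(x^k+\sigma u^k)-f(x^k)\big]u^k,\qquad x^{k+1}=P_\Omega\Big(x^k-\tau_k\,\frac{v^k}{\|x^k\|^m+1}\Big),\qquad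 k=0,1,2,\dots$$ Let $\gamma\in(0,1]$, let $T$ be a positive integer, and suppose that $\tau_k=\gamma/\sqrt{T+1}$ for $k=0,\dots,T$. Define $$\mathcal{M}(x)=\big(2^{m-1}{\rm R}_1\|x\|^m+{\rm R}_2\big)\sqrt d+2^{m-1}{\rm R}_1\sigma^m(m+1+d)^{\frac{m+1}{2}},$$ $$\mathcal{H}_{(2)}=3\max\big\{2^{2(m-1)}{\rm R}_1^2(4+d)^2,\ {\rm R}_2^2(4+d)^2+2^{2(m-1)}{\rm R}_1^2\sigma^{2m}[2(m+2)+d]^{m+2}\big\},$$ $$C_{\rm lev}=\sup\{\|x\|: x\in\mathbb{R}^d,\ f(x)\le f(x^*)+\mathcal{M}(x^*)\sigma\},$$ $$M_{\rm bd}=4\|x^0\|^2+6C_{\rm lev}^2+2\mathcal{H}_{(2)}\gamma^2,\qquad C_{\rm bd}=\frac1{2\gamma}\big(\|x^0-x^*\|^2+\mathcal{H}_{(2)}\gamma^2\big).$$ Then $C_{\rm lev}<\infty$, the expectations below are finite, and $$\min_{0\le k\le T}\mathbb{E}\Big[(f(x^k)-f(x^*))^{\frac{1}{2\lceil m/2\rceil}}\Big]\le\big(1+\sqrt{M_{\rm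 bd}}\big)\big(2C_{\rm bd}T^{-1/2}+2\mathcal{M}(x^*)\sigma\big)^{\frac{1}{2\lceil m/2\rceil}}.$$ -/

import Mathlib

open MeasureTheory ProbabilityTheory Filter Topology

noncomputable section

namespace SPB

variable {d : ℕ}

/-- The Clarke directional derivative `f°(x; v)`, the limsup of the difference quotients
`(f (x' + t v) - f x') / t` as `x' → x` and `t ↓ 0`. It is used only for locally Lipschitz `f`, where
the quotients are bounded near `(x, 0)`, so that the real `limsup` is the genuine one. -/
def clarkeDirDeriv (f : EuclideanSpace ℝ (Fin d) → ℝ) (x v : EuclideanSpace ℝ (Fin d)) : ℝ :=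
  limsup (fun p : EuclideanSpace ℝ (Fin d) × ℝ => (f (p.1 + p.2 • v) - f p.1) / p.2)
    (𝓝 x ×ˢ 𝓝[>] (0 : ℝ))

/-- The Clarke subdifferential `∂_C f(x)`. -/
def clarkeSubdiff (f : EuclideanSpace ℝ (Fin d) → ℝ) (x : EuclideanSpace ℝ (Fin d)) :
    Set (EuclideanSpace ℝ (Fin d)) :=
  {s | ∀ v, inner ℝ s v ≤ clarkeDirDeriv f x v}

/-- `f` is subdifferentially polynomially bounded with parameters `R₁`, `R₂`, `m`. -/
structure IsSPBWith (f : EuclideanSpace ℝ (Fin d) → ℝ) (R₁ R₂ : ℝ) (m : ℕ) : Prop where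
  locallyLipschitz : LocallyLipschitz f
  R₁_nonneg : 0 ≤ R₁
  R₂_pos : 0 < R₂
  R₁_eq_zero_iff : R₁ = 0 ↔ m = 0
  bound : ∀ x, ∀ ζ ∈ clarkeSubdiff f x, ‖ζ‖ ≤ R₁ * ‖x‖ ^ m + R₂

/-- All sublevel sets of `f` (on the whole space) are bounded. -/
def LevelBounded (f : EuclideanSpace ℝ (Fin d) → ℝ) : Prop :=
  ∀ α : ℝ, Bornology.IsBounded {x | f x ≤ α}

/-- `p` is a point of `S` nearest to `y`. For a nonempty closed convex `S` there is exactly one,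
the projection `P_S(y)`. -/
def IsProj (S : Set (EuclideanSpace ℝ (Fin d))) (y p : EuclideanSpace ℝ (Fin d)) : Prop :=
  p ∈ S ∧ ∀ z ∈ S, ‖y - p‖ ≤ ‖y - z‖

/-- The random direction `v = (1/σ) (f (x + σ u) - f x) u`. -/
def gsDir (f : EuclideanSpace ℝ (Fin d) → ℝ) (σ : ℝ) (x u : EuclideanSpace ℝ (Fin d)) :
    EuclideanSpace ℝ (Fin d) :=
  ((1 / σ) * (f (x + σ • u) - f x)) • u

/-- `x` is the random sequence of iterates of the Gaussian-smoothing-based zeroth-order projected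
method for minimizing `f` over `Ω`, with exponent `m`, stepsizes `τ`, smoothing parameter `σ`,
deterministic starting point `x₀`, and random directions `u 0, u 1, …`, which are independent
standard Gaussian vectors on the probability space `(Ξ, P)`. -/
structure IsGSRun {Ξ : Type*} [MeasurableSpace Ξ] (P : Measure Ξ)
    (f : EuclideanSpace ℝ (Fin d) → ℝ) (Ω : Set (EuclideanSpace ℝ (Fin d))) (m : ℕ)
    (τ : ℕ → ℝ) (σ : ℝ) (x₀ : EuclideanSpace ℝ (Fin d))
    (u x : ℕ → Ξ → EuclideanSpace ℝ (Fin d)) : Prop where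
  sigma_pos : 0 < σ
  tau_mem : ∀ k, τ k ∈ Set.Ioc (0 : ℝ) 1
  init_mem : x₀ ∈ Ω
  measurable_dir : ∀ k, Measurable (u k)
  law_dir : ∀ k, P.map (u k) = stdGaussian (EuclideanSpace ℝ (Fin d))
  indep_dir : iIndepFun u P
  init : ∀ ω, x 0 ω = x₀
  step : ∀ k ω,
    IsProj Ω (x k ω - (τ k / (‖x k ω‖ ^ m + 1)) • gsDir f σ (x k ω) (u k ω)) (x (k + 1) ω)

/-- The function `𝓜(x)`. -/
def scriptM (R₁ R₂ : ℝ) (m : ℕ) (σ : ℝ) (x : EuclideanSpace ℝ (Fin d)) : ℝ :=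
  ((2 : ℝ) ^ ((m : ℤ) - 1) * R₁ * ‖x‖ ^ m + R₂) * √(d : ℝ) +
    (2 : ℝ) ^ ((m : ℤ) - 1) * R₁ * σ ^ m * ((m : ℝ) + 1 + d) ^ (((m : ℝ) + 1) / 2)

/-- The constant `ℋ_(p)` (in dimension `d`). -/
def scriptH (d : ℕ) (R₁ R₂ : ℝ) (m : ℕ) (σ : ℝ) (p : ℕ) : ℝ :=
  if p = 0 then 1 else
    (3 : ℝ) ^ (p - 1) *
      max ((2 : ℝ) ^ (((m : ℤ) - 1) * p) * R₁ ^ p * (2 * (p : ℝ) + d) ^ p)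
        (R₂ ^ p * (2 * (p : ℝ) + d) ^ p +
          (2 : ℝ) ^ (((m : ℤ) - 1) * p) * R₁ ^ p * σ ^ (m * p) *
            (((m : ℝ) + 2) * p + d) ^ (((m : ℝ) + 2) * p / 2))

/-- The set of the norms `‖x‖` of all `x` with `f x ≤ f xs + 𝓜(xs) σ`. -/
def levNorms (f : EuclideanSpace ℝ (Fin d) → ℝ) (R₁ R₂ : ℝ) (m : ℕ) (σ : ℝ)
    (xs : EuclideanSpace ℝ (Fin d)) : Set ℝ :=
  (fun x => ‖x‖) '' {x | f x ≤ f xs + scriptM R₁ R₂ m σ xs * σ}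

/-- The constant `C_lev`. -/
def Clev (f : EuclideanSpace ℝ (Fin d) → ℝ) (R₁ R₂ : ℝ) (m : ℕ) (σ : ℝ)
    (xs : EuclideanSpace ℝ (Fin d)) : ℝ :=
  sSup (levNorms f R₁ R₂ m σ xs)

/-- The constant `M_bd`. -/
def Mbd (f : EuclideanSpace ℝ (Fin d) → ℝ) (R₁ R₂ : ℝ) (m : ℕ) (σ γ : ℝ)
    (x₀ xs : EuclideanSpace ℝ (Fin d)) : ℝ :=
  4 * ‖x₀‖ ^ 2 + 6 * Clev f R₁ R₂ m σ xs ^ 2 + 2 * scriptH d R₁ R₂ m σ 2 * γ ^ 2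

/-- The constant `C_bd`. -/
def Cbd (R₁ R₂ : ℝ) (m : ℕ) (σ γ : ℝ) (x₀ xs : EuclideanSpace ℝ (Fin d)) : ℝ :=
  1 / (2 * γ) * (‖x₀ - xs‖ ^ 2 + scriptH d R₁ R₂ m σ 2 * γ ^ 2)

/-- The exponent `1 / (2 ⌈m/2⌉)`. -/
def expo (m : ℕ) : ℝ :=
  1 / (2 * (⌈(m : ℝ) / 2⌉₊ : ℝ))

end SPB

end

/-! The argument compares `f` with its Gaussian smoothing `gaussSmooth f σ`, written f_σ. Convexity
gives f ≤ f_σ (`le_gaussSmooth`), and the growth of `f` gives f_σ ≤ f + 𝓜σ (`gaussSmooth_le`). The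
smoothing is again convex, and the mean of `gsDir f σ x u` over u is a subgradient of f_σ at x
(`integral_inner_gsDir_ge`). The method is thus a stochastic projected subgradient method for f_σ.
The second moment of the direction is at most ℋ(‖x‖^m + 1)² (`integral_norm_sq_gsDir_le`), which is
what the normalised stepsize cancels.

Nonexpansiveness of the projection and independence of `x k` and `u k` then give the one-step
inequality `integral_norm_sq_step_le`, stated for a reference point y in Ω and any lower bound φ of
f_σ - f_σ(y). It is used twice. With y a minimizer z of f_σ over Ω and φ = 0 there is no upward
drift beyond τ²ℋ, so the second moments of the iterates stay below M_bd; level-boundedness gives z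
and ‖z‖ ≤ C_lev. With y = x* and φ = f - f(x*) - 𝓜σ, telescoping produces an index at which the mean
of the gap divided by ‖x‖^m + 1 is small.

The weight is removed in `integral_rpow_le_of_weighted`: a small power of the gap is split into a
power of the weighted gap and a factor at most 1 + ‖x‖, and Cauchy-Schwarz, Jensen and the
second-moment bound finish. -/

namespace SPB

/-! ### Moments and translations of the standard Gaussian measure. -/

section Gaussian

variable {d : ℕ}

lemma integrable_exp_norm_stdGaussian (c : ℝ) :
    Integrable (fun u : EuclideanSpace ℝ (Fin d) => Real.exp (c * ‖u‖))
      (stdGaussian (EuclideanSpace ℝ (Fin d))) := by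
  obtain ⟨C, hC, hint⟩ :=
    IsGaussian.exists_integrable_exp_sq (stdGaussian (EuclideanSpace ℝ (Fin d)))
  -- Fernique's theorem supplies C; completing the square gives c r ≤ C r² + c²/(4C).
  refine (hint.const_mul (Real.exp (c ^ 2 / (4 * C)))).mono' (by fun_prop)
    (Eventually.of_forall fun u => ?_)
  rw [Real.norm_eq_abs, abs_of_pos (Real.exp_pos _), ← Real.exp_add, Real.exp_le_exp]
  have : c ^ 2 / (4 * C) + C * ‖u‖ ^ 2 - c * ‖u‖ = (c - 2 * C * ‖u‖) ^ 2 / (4 * C) := by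
    field_simp; ring
  have h2 : 0 ≤ (c - 2 * C * ‖u‖) ^ 2 / (4 * C) := by positivity
  linarith

lemma integrable_of_abs_le_exp_norm {F : EuclideanSpace ℝ (Fin d) → ℝ} (hF : Measurable F)
    {C c : ℝ} (hb : ∀ u, |F u| ≤ C * Real.exp (c * ‖u‖)) :
    Integrable F (stdGaussian (EuclideanSpace ℝ (Fin d))) :=
  ((integrable_exp_norm_stdGaussian c).const_mul C).mono' hF.aestronglyMeasurable
    (Eventually.of_forall hb)

lemma integrable_norm_pow_stdGaussian (p : ℕ) :
    Integrable (fun u : EuclideanSpace ℝ (Fin d) => ‖u‖ ^ p)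
      (stdGaussian (EuclideanSpace ℝ (Fin d))) := by
  refine integrable_of_abs_le_exp_norm (C := p.factorial) (c := 1) (by fun_prop) fun u => ?_
  have := Real.pow_div_factorial_le_exp ‖u‖ (norm_nonneg u) p
  rw [div_le_iff₀ (by positivity)] at this
  rw [abs_of_nonneg (by positivity), one_mul]
  linarith

lemma integral_exp_sq_gaussianReal {s : ℝ} (hs : s < 1) :
    ∫ x, Real.exp (s * x ^ 2 / 2) ∂(gaussianReal 0 1) = √(1 / (1 - s)) := by
  rw [integral_gaussianReal_eq_integral_smul one_ne_zero]
  have : ∀ x : ℝ, gaussianPDFReal 0 1 x • Real.exp (s * x ^ 2 / 2)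
      = (√(2 * Real.pi))⁻¹ * Real.exp (-((1 - s) / 2) * x ^ 2) := by
    intro x
    rw [gaussianPDFReal_def, smul_eq_mul, mul_assoc, ← Real.exp_add]
    simp only [NNReal.coe_one, mul_one, sub_zero]
    congr 2; ring
  simp_rw [this]
  rw [integral_const_mul, integral_gaussian, ← Real.sqrt_inv, ← Real.sqrt_mul (by positivity)]
  congr 1
  have : 1 - s ≠ 0 := by linarith
  field_simp

lemma integral_exp_norm_sq_stdGaussian {s : ℝ} (hs : s < 1) :
    ∫ u, Real.exp (s * ‖u‖ ^ 2 / 2) ∂(stdGaussian (EuclideanSpace ℝ (Fin d)))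
      = √(1 / (1 - s)) ^ d := by
  rw [← map_pi_eq_stdGaussian, integral_map (by fun_prop) (by fun_prop)]
  have : ∀ x : Fin d → ℝ, Real.exp (s * ‖WithLp.toLp 2 x‖ ^ 2 / 2)
      = ∏ i, Real.exp (s * x i ^ 2 / 2) := by
    intro x
    rw [EuclideanSpace.real_norm_sq_eq, ← Real.exp_sum, Finset.mul_sum, Finset.sum_div]
  simp_rw [this]
  rw [integral_fintype_prod_eq_pow (f := fun y : ℝ => Real.exp (s * y ^ 2 / 2)),
    integral_exp_sq_gaussianReal hs, Fintype.card_fin]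

/-- The moments of the norm of a standard Gaussian vector. -/
lemma integral_norm_pow_stdGaussian_le {p : ℕ} (hp : p ≠ 0) :
    ∫ u, ‖u‖ ^ p ∂(stdGaussian (EuclideanSpace ℝ (Fin d))) ≤ ((p : ℝ) + d) ^ ((p : ℝ) / 2) := by
  -- Dimension 0 is separate because the parameter `s` below would equal 1.
  rcases Nat.eq_zero_or_pos d with rfl | hd
  · have : ∀ u : EuclideanSpace ℝ (Fin 0), ‖u‖ ^ p = 0 := fun u => by
      rw [Subsingleton.elim u 0, norm_zero, zero_pow hp]
    simp_rw [this]
    simp only [integral_zero]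
    positivity
  have hp' : (0 : ℝ) < p := by positivity
  have hd' : (0 : ℝ) < d := by positivity
  -- Raising y ≤ exp(y - 1), y = ‖u‖²/(p + d), to the power p/2 produces exactly exp(s‖u‖²/2) and a
  -- factor e^(-p/2). The integral (1 + p/d)^(d/2) is at most e^(p/2), so the exponentials cancel.
  set s : ℝ := p / (p + d) with hs
  have hs1 : s < 1 := by rw [hs, div_lt_one (by positivity)]; linarith
  have hint := integral_exp_norm_sq_stdGaussian (d := d) hs1
  have hI : Integrable (fun u : EuclideanSpace ℝ (Fin d) => Real.exp (s * ‖u‖ ^ 2 / 2))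
      (stdGaussian (EuclideanSpace ℝ (Fin d))) := by
    -- A non-integrable function has integral 0 by default, but the value computed above is
    -- positive.
    by_contra h
    rw [integral_undef h] at hint
    have : 0 < 1 - s := by linarith
    have : 0 < √(1 / (1 - s)) ^ d := by positivity
    linarith
  set K : ℝ := ((p : ℝ) + d) ^ ((p : ℝ) / 2) * Real.exp (-(p / 2)) with hK
  have hpt : ∀ u : EuclideanSpace ℝ (Fin d), ‖u‖ ^ p ≤ K * Real.exp (s * ‖u‖ ^ 2 / 2) := by
    intro u
    set y : ℝ := ‖u‖ ^ 2 / (p + d) with hy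
    have hy0 : 0 ≤ y := by positivity
    have h1 : y ≤ Real.exp (y - 1) := by linarith [Real.add_one_le_exp (y - 1)]
    have h2 : y ^ ((p : ℝ) / 2) ≤ Real.exp (-(p / 2)) * Real.exp (s * ‖u‖ ^ 2 / 2) := by
      calc y ^ ((p : ℝ) / 2) ≤ (Real.exp (y - 1)) ^ ((p : ℝ) / 2) :=
            Real.rpow_le_rpow hy0 h1 (by positivity)
        _ = Real.exp (-(p / 2)) * Real.exp (s * ‖u‖ ^ 2 / 2) := by
            rw [← Real.exp_mul, ← Real.exp_add]
            congr 1
            rw [hy, hs]; field_simp; ring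
    have h3 : ‖u‖ ^ p = ((p : ℝ) + d) ^ ((p : ℝ) / 2) * y ^ ((p : ℝ) / 2) := by
      rw [← Real.mul_rpow (by positivity) hy0, hy, mul_div_cancel₀ _ (by positivity),
        ← Real.rpow_natCast ‖u‖ 2, ← Real.rpow_mul (norm_nonneg _), ← Real.rpow_natCast]
      congr 1; push_cast; ring
    rw [h3, hK, mul_assoc]
    exact mul_le_mul_of_nonneg_left h2 (by positivity)
  calc ∫ u, ‖u‖ ^ p ∂(stdGaussian (EuclideanSpace ℝ (Fin d)))
      ≤ ∫ u, K * Real.exp (s * ‖u‖ ^ 2 / 2) ∂(stdGaussian (EuclideanSpace ℝ (Fin d))) :=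
        integral_mono (integrable_norm_pow_stdGaussian p) (hI.const_mul K) hpt
    _ = K * √(1 / (1 - s)) ^ d := by rw [integral_const_mul, hint]
    _ ≤ K * Real.exp (p / 2) := by
        have h1 : √(1 / (1 - s)) ≤ Real.exp (p / (2 * d)) := by
          rw [Real.sqrt_le_left (Real.exp_pos _).le, ← Real.exp_nat_mul]
          have : 1 / (1 - s) = p / d + 1 := by
            rw [hs]; field_simp
            rw [div_eq_iff (by linarith)]; ring
          rw [this]
          refine (Real.add_one_le_exp _).trans_eq ?_
          congr 1; push_cast; field_simp
        have h2 : √(1 / (1 - s)) ^ d ≤ Real.exp (p / (2 * d)) ^ d :=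
          pow_le_pow_left₀ (Real.sqrt_nonneg _) h1 d
        have h3 : Real.exp (p / (2 * d)) ^ d = Real.exp (p / 2) := by
          rw [← Real.exp_nat_mul]; congr 1; field_simp
        rw [h3] at h2
        exact mul_le_mul_of_nonneg_left h2 (by positivity)
    _ = ((p : ℝ) + d) ^ ((p : ℝ) / 2) := by
        rw [hK, mul_assoc, ← Real.exp_add]; simp

lemma integral_norm_sq_stdGaussian :
    ∫ u, ‖u‖ ^ 2 ∂(stdGaussian (EuclideanSpace ℝ (Fin d))) = d := by
  have h : ∀ i : Fin d, Integrable (fun x : Fin d → ℝ => x i ^ 2)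
      (Measure.pi fun _ => gaussianReal 0 1) := fun i =>
    integrable_comp_eval (μ := fun _ : Fin d => gaussianReal 0 1) (i := i)
      (f := fun y : ℝ => y ^ 2) (memLp_id_gaussianReal 2).integrable_sq
  rw [← map_pi_eq_stdGaussian, integral_map (by fun_prop) (by fun_prop)]
  simp_rw [EuclideanSpace.real_norm_sq_eq]
  rw [integral_finsetSum _ fun i _ => h i]
  have h1 : ∫ y : ℝ, y ^ 2 ∂(gaussianReal 0 1) = 1 := by
    have := variance_of_integral_eq_zero (μ := gaussianReal 0 1) (X := id) (by fun_prop)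
      (by simp)
    simpa using this.symm
  have h2 : ∀ i : Fin d, ∫ x : Fin d → ℝ, x i ^ 2 ∂(Measure.pi fun _ => gaussianReal 0 1) = 1 := by
    intro i
    rw [← h1]
    exact integral_comp_eval (μ := fun _ : Fin d => gaussianReal 0 1) (i := i)
      (f := fun y : ℝ => y ^ 2) (by fun_prop)
  simp [h2]

lemma sq_integral_le_integral_sq {Ξ : Type*} [MeasurableSpace Ξ] {P : Measure Ξ}
    [IsProbabilityMeasure P] {N : Ξ → ℝ} (hi : Integrable N P)
    (hi2 : Integrable (fun ω => N ω ^ 2) P) : (∫ ω, N ω ∂P) ^ 2 ≤ ∫ ω, N ω ^ 2 ∂P := by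
  set a := ∫ ω, N ω ∂P
  have h3 : 0 ≤ ∫ ω, (N ω - a) ^ 2 ∂P := integral_nonneg fun ω => by positivity
  have h4 : ∫ ω, (N ω - a) ^ 2 ∂P = ∫ ω, N ω ^ 2 ∂P - 2 * a * a + a ^ 2 := by
    have : ∀ ω, (N ω - a) ^ 2 = N ω ^ 2 - 2 * a * N ω + a ^ 2 := fun ω => by ring
    simp_rw [this]
    have h5 : Integrable (fun ω => N ω ^ 2 - 2 * a * N ω) P := hi2.sub (hi.const_mul _)
    rw [integral_add h5 (integrable_const _), integral_sub hi2 (hi.const_mul _),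
      integral_const_mul]
    simp [a]
  linarith [sq a]

lemma integral_norm_stdGaussian_le :
    ∫ u, ‖u‖ ∂(stdGaussian (EuclideanSpace ℝ (Fin d))) ≤ √(d : ℝ) := by
  refine Real.le_sqrt_of_sq_le ?_
  rw [← integral_norm_sq_stdGaussian (d := d)]
  exact sq_integral_le_integral_sq (by simpa using integrable_norm_pow_stdGaussian (d := d) 1)
    (integrable_norm_pow_stdGaussian 2)

lemma integrable_exp_inner_stdGaussian (h : EuclideanSpace ℝ (Fin d)) (c : ℝ) :
    Integrable (fun u => Real.exp (inner ℝ h u + c))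
      (stdGaussian (EuclideanSpace ℝ (Fin d))) := by
  refine integrable_of_abs_le_exp_norm (C := Real.exp c) (c := ‖h‖) (by fun_prop) fun u => ?_
  rw [abs_of_pos (Real.exp_pos _), ← Real.exp_add, Real.exp_le_exp, add_comm]
  linarith [real_inner_le_norm h u]

/-- The Cameron-Martin formula for translations of the standard Gaussian measure. -/
lemma map_add_const_stdGaussian (h : EuclideanSpace ℝ (Fin d)) :
    (stdGaussian (EuclideanSpace ℝ (Fin d))).map (fun u => u + h)
      = (stdGaussian (EuclideanSpace ℝ (Fin d))).withDensity
        (fun u => ENNReal.ofReal (Real.exp (inner ℝ h u + -(‖h‖ ^ 2 / 2)))) := by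
  have := isFiniteMeasure_withDensity_ofReal
    (integrable_exp_inner_stdGaussian h (-(‖h‖ ^ 2 / 2))).2
  apply Measure.ext_of_charFun
  ext t
  rw [charFun_map_add_const, charFun_stdGaussian, charFun_apply,
    integral_withDensity_eq_integral_toReal_smul (by fun_prop) (by simp)]
  rw [← map_pi_eq_stdGaussian, integral_map (by fun_prop) (by fun_prop)]
  -- The characteristic function of the weighted measure factors over coordinates; each factor is
  -- the complex Gaussian moment generating function exp(z²/2) at z = hᵢ + i tᵢ.
  have key : ∀ x : Fin d → ℝ,
      (ENNReal.ofReal (Real.exp (inner ℝ h (WithLp.toLp 2 x) + -(‖h‖ ^ 2 / 2)))).toReal •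
        Complex.exp ((inner ℝ (WithLp.toLp 2 x) t : ℝ) * Complex.I)
      = ∏ i, (Complex.exp (-(h i : ℂ) ^ 2 / 2) *
          Complex.exp (((h i : ℂ) + t i * Complex.I) * x i)) := by
    intro x
    rw [ENNReal.toReal_ofReal (Real.exp_pos _).le, Complex.real_smul, Complex.ofReal_exp,
      ← Complex.exp_add]
    simp_rw [← Complex.exp_add]
    rw [← Complex.exp_sum]
    congr 1
    rw [EuclideanSpace.real_norm_sq_eq]
    simp only [PiLp.inner_apply, RCLike.inner_apply, conj_trivial]
    push_cast
    rw [Finset.sum_mul, Finset.sum_div, ← Finset.sum_neg_distrib, ← Finset.sum_add_distrib,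
      ← Finset.sum_add_distrib]
    exact Finset.sum_congr rfl fun i _ => by ring
  simp_rw [key]
  rw [integral_fintype_prod_eq_prod
    (f := fun i (y : ℝ) => Complex.exp (-(h i : ℂ) ^ 2 / 2) *
          Complex.exp (((h i : ℂ) + t i * Complex.I) * y))]
  have h1 : ∀ z : ℂ, ∫ y : ℝ, Complex.exp (z * y) ∂(gaussianReal 0 1) = Complex.exp (z ^ 2 / 2) := by
    intro z
    have := complexMGF_id_gaussianReal (μ := 0) (v := 1) z
    simpa [complexMGF] using this
  simp_rw [integral_const_mul, h1, ← Complex.exp_add]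
  rw [← Complex.exp_sum]
  congr 1
  rw [← Complex.ofReal_pow, EuclideanSpace.real_norm_sq_eq]
  simp only [PiLp.inner_apply, RCLike.inner_apply, conj_trivial]
  push_cast
  rw [Finset.sum_mul, ← Finset.sum_neg_distrib, Finset.sum_div, ← Finset.sum_add_distrib]
  refine Finset.sum_congr rfl fun i _ => ?_
  linear_combination (t i : ℂ) ^ 2 / 2 * -Complex.I_sq

lemma integral_add_const_stdGaussian {F : EuclideanSpace ℝ (Fin d) → ℝ} (hF : Measurable F)
    (h : EuclideanSpace ℝ (Fin d)) :
    ∫ u, F (u + h) ∂(stdGaussian (EuclideanSpace ℝ (Fin d)))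
      = ∫ u, Real.exp (inner ℝ h u + -(‖h‖ ^ 2 / 2)) * F u
        ∂(stdGaussian (EuclideanSpace ℝ (Fin d))) := by
  rw [← integral_map (f := F) (φ := fun u => u + h) (by fun_prop) hF.aestronglyMeasurable,
    map_add_const_stdGaussian, integral_withDensity_eq_integral_toReal_smul (by fun_prop) (by simp)]
  refine integral_congr_ae (Eventually.of_forall fun u => ?_)
  simp only [smul_eq_mul]
  rw [ENNReal.toReal_ofReal (Real.exp_pos _).le]

end Gaussian

/-! ### Gaussian integration by parts for convex functions. -/

section Stein

variable {d : ℕ}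

/-- A convex function of at most exponential growth satisfies the gradient inequality for its
Gaussian average, with the gradient written as a Stein-type integral. -/
lemma integral_mul_inner_stdGaussian_ge {F : EuclideanSpace ℝ (Fin d) → ℝ}
    (hFm : Measurable F) (hFc : ConvexOn ℝ Set.univ F) {C c : ℝ} (hc : 0 ≤ c)
    (hb : ∀ u, |F u| ≤ C * Real.exp (c * ‖u‖)) (h : EuclideanSpace ℝ (Fin d)) :
    Integrable (fun u => F u * inner ℝ h u) (stdGaussian (EuclideanSpace ℝ (Fin d))) ∧
    ∫ u, F u ∂(stdGaussian (EuclideanSpace ℝ (Fin d)))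
      - ∫ u, F (u - h) ∂(stdGaussian (EuclideanSpace ℝ (Fin d)))
      ≤ ∫ u, F u * inner ℝ h u ∂(stdGaussian (EuclideanSpace ℝ (Fin d))) := by
  set μ := stdGaussian (EuclideanSpace ℝ (Fin d))
  have hC : 0 ≤ C := by
    have := (abs_nonneg _).trans (hb 0)
    simpa using this
  have hint : ∀ w, Integrable (fun u => F (u + w)) μ := fun w => by
    refine integrable_of_abs_le_exp_norm (C := C * Real.exp (c * ‖w‖)) (c := c)
      (by fun_prop) fun u => (hb _).trans ?_
    rw [mul_assoc, ← Real.exp_add]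
    gcongr
    nlinarith [norm_add_le u w]
  -- By Cameron-Martin, the integral of `G t` is that of F(u - t h). The t-derivative `G'` falls on
  -- the density, so `F` need not be differentiable.
  let G : ℝ → EuclideanSpace ℝ (Fin d) → ℝ := fun t u =>
    Real.exp (inner ℝ ((-t) • h) u + -(‖(-t) • h‖ ^ 2 / 2)) * F u
  let G' : ℝ → EuclideanSpace ℝ (Fin d) → ℝ := fun t u =>
    Real.exp (inner ℝ ((-t) • h) u + -(‖(-t) • h‖ ^ 2 / 2)) *
      (-inner ℝ h u - t * ‖h‖ ^ 2) * F u
  have hGexp : ∀ (t : ℝ) (u : EuclideanSpace ℝ (Fin d)),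
      inner ℝ ((-t) • h) u + -(‖(-t) • h‖ ^ 2 / 2)
        = -t * inner ℝ h u - t ^ 2 * (‖h‖ ^ 2 / 2) := fun t u => by
    rw [real_inner_smul_left, norm_smul, mul_pow, Real.norm_eq_abs, sq_abs]; ring
  have hGint : ∀ t, ∫ u, G t u ∂μ = ∫ u, F (u - t • h) ∂μ := fun t => by
    rw [← integral_add_const_stdGaussian hFm ((-t) • h)]
    simp [sub_eq_add_neg, μ]
  have hbd : ∀ u, ∀ t ∈ Metric.ball (0 : ℝ) 1,
      ‖G' t u‖ ≤ C * (1 + ‖h‖ ^ 2) * Real.exp ((2 * ‖h‖ + c) * ‖u‖) := by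
    intro u t ht
    have ht : |t| ≤ 1 := by simpa using (mem_ball_zero_iff.1 ht).le
    have ha : |inner ℝ h u| ≤ ‖h‖ * ‖u‖ := abs_real_inner_le_norm h u
    have hta : |t| * |inner ℝ h u| ≤ ‖h‖ * ‖u‖ :=
      (mul_le_of_le_one_left (abs_nonneg _) ht).trans ha
    have h1 : Real.exp (inner ℝ ((-t) • h) u + -(‖(-t) • h‖ ^ 2 / 2))
        ≤ Real.exp (‖h‖ * ‖u‖) := by
      rw [Real.exp_le_exp, hGexp]
      have := neg_abs_le (t * inner ℝ h u)
      rw [abs_mul] at this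
      have : 0 ≤ t ^ 2 * (‖h‖ ^ 2 / 2) := by positivity
      linarith
    have h2 : |(-inner ℝ h u - t * ‖h‖ ^ 2)| ≤ (1 + ‖h‖ ^ 2) * Real.exp (‖h‖ * ‖u‖) := by
      have e1 : ‖h‖ * ‖u‖ + 1 ≤ Real.exp (‖h‖ * ‖u‖) := Real.add_one_le_exp _
      have e2 : 1 ≤ Real.exp (‖h‖ * ‖u‖) := Real.one_le_exp (by positivity)
      have e3 : |t * ‖h‖ ^ 2| ≤ ‖h‖ ^ 2 := by
        rw [abs_mul, abs_of_nonneg (sq_nonneg ‖h‖)]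
        exact mul_le_of_le_one_left (sq_nonneg _) ht
      have e4 := abs_sub (-inner ℝ h u) (t * ‖h‖ ^ 2)
      rw [abs_neg] at e4
      nlinarith [sq_nonneg ‖h‖]
    simp only [G', Real.norm_eq_abs, abs_mul, abs_of_pos (Real.exp_pos _)]
    calc _ ≤ Real.exp (‖h‖ * ‖u‖) * ((1 + ‖h‖ ^ 2) * Real.exp (‖h‖ * ‖u‖)) *
          (C * Real.exp (c * ‖u‖)) := by
          gcongr
          exact hb u
      _ = C * (1 + ‖h‖ ^ 2) * (Real.exp (‖h‖ * ‖u‖) * Real.exp (‖h‖ * ‖u‖) *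
          Real.exp (c * ‖u‖)) := by ring
      _ = _ := by
          rw [← Real.exp_add, ← Real.exp_add]; congr 2; ring
  have hder := hasDerivAt_integral_of_dominated_loc_of_deriv_le (μ := μ) (F := G) (F' := G')
    (x₀ := (0 : ℝ)) (s := Metric.ball 0 1)
    (bound := fun u => C * (1 + ‖h‖ ^ 2) * Real.exp ((2 * ‖h‖ + c) * ‖u‖))
    (Metric.ball_mem_nhds _ one_pos)
    (Eventually.of_forall fun t => Measurable.aestronglyMeasurable (by fun_prop))
    (by simpa [G] using hint 0) (Measurable.aestronglyMeasurable (by fun_prop))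
    (Eventually.of_forall hbd) ((integrable_exp_norm_stdGaussian _).const_mul _)
    (Eventually.of_forall fun u t _ => by
      have hd : HasDerivAt (fun s : ℝ => -s * inner ℝ h u - s ^ 2 * (‖h‖ ^ 2 / 2))
          (-inner ℝ h u - t * ‖h‖ ^ 2) t := by
        have h1 := ((hasDerivAt_id t).neg.mul_const (inner ℝ h u)).sub
          ((hasDerivAt_pow 2 t).mul_const (‖h‖ ^ 2 / 2))
        convert! h1 using 1
        push_cast; ring
      have := hd.exp.mul_const (F u)
      simpa only [G, G', hGexp] using this)
  obtain ⟨hI, hD⟩ := hder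
  have hG0 : G' 0 = fun u => -(F u * inner ℝ h u) := by
    ext u; simp [G']; ring
  rw [hG0] at hI hD
  have hI' : Integrable (fun u => F u * inner ℝ h u) μ := by simpa using hI.neg
  refine ⟨hI', ?_⟩
  rw [integral_neg] at hD
  simp_rw [hGint] at hD
  have hslope := hD.tendsto_slope_zero_right
  -- The left side is the derivative at t = 0; convexity bounds every difference quotient with 0 < t
  -- < 1 by the quotient at t = 1.
  have hle : -∫ u, F u * inner ℝ h u ∂μ ≤ ∫ u, F (u - h) ∂μ - ∫ u, F u ∂μ := by
    refine le_of_tendsto hslope ?_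
    filter_upwards [Ioo_mem_nhdsGT (zero_lt_one' ℝ)] with t ht
    simp only [zero_add, zero_smul, sub_zero, smul_eq_mul]
    rw [inv_mul_le_iff₀ ht.1, sub_le_iff_le_add]
    have h1 : ∫ u, F (u - t • h) ∂μ ≤ ∫ u, ((1 - t) * F u + t * F (u - h)) ∂μ := by
      refine integral_mono (by simpa [sub_eq_add_neg] using hint (-(t • h)))
        (((by simpa using hint 0 : Integrable F μ).const_mul _).add
          ((by simpa [sub_eq_add_neg] using hint (-h) :
            Integrable (fun u => F (u - h)) μ).const_mul _)) fun u => ?_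
      have := hFc.2 (Set.mem_univ u) (Set.mem_univ (u - h)) (by linarith [ht.2] : 0 ≤ 1 - t)
        ht.1.le (by ring)
      have e : (1 - t) • u + t • (u - h) = u - t • h := by module
      rw [e] at this
      simpa using this
    rw [integral_add ((by simpa using hint 0 : Integrable F μ).const_mul _)
          ((by simpa [sub_eq_add_neg] using hint (-h) :
            Integrable (fun u => F (u - h)) μ).const_mul _), integral_const_mul,
          integral_const_mul] at h1
    linarith
  linarith

end Stein

/-! ### Convex subgradients and growth of `f`. -/

section Convex

/-- A continuous convex function on a normed space has a subgradient at every point. -/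
lemma exists_subgradient {E : Type*} [NormedAddCommGroup E] [NormedSpace ℝ E] {f : E → ℝ}
    (hf : ConvexOn ℝ Set.univ f) (hc : Continuous f) (x : E) :
    ∃ L : E →L[ℝ] ℝ, ∀ y, f x + L (y - x) ≤ f y := by
  let A : Set (E × ℝ) := {p | p.1 ∈ Set.univ ∧ f p.1 < p.2}
  have hA : Convex ℝ A := hf.convex_strict_epigraph
  have hAo : IsOpen A := by
    simp only [A, Set.mem_univ, true_and]
    exact isOpen_lt (by fun_prop) (by fun_prop)
  -- The point of the graph is separated from the open strict epigraph. The functional is not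
  -- vertical (`β < 0`), and dividing by -β gives the subgradient.
  obtain ⟨L, hL⟩ := geometric_hahn_banach_open_point (x := (x, f x)) hA hAo (by simp [A])
  set β := L (0, 1)
  set l : E →L[ℝ] ℝ := L.comp (.inl ℝ E ℝ)
  have hdec : ∀ (y : E) (t : ℝ), L (y, t) = l y + t * β := fun y t => by
    have : (y, t) = (y, 0) + t • ((0, 1) : E × ℝ) := by simp
    rw [this, map_add, map_smul]; simp [l, β]
  have hβ : β < 0 := by
    have := hL (x, f x + 1) (by simp [A])
    rw [hdec, hdec] at this
    linarith
  have key : ∀ y, l y + f y * β ≤ l x + f x * β := fun y => by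
    have : ∀ᶠ t in 𝓝[>] (f y), l y + t * β ≤ l x + f x * β := by
      filter_upwards [self_mem_nhdsWithin] with t ht
      have := hL (y, t) (by simpa [A] using ht)
      rw [hdec, hdec] at this
      exact this.le
    refine le_of_tendsto (x := 𝓝[>] (f y)) (f := fun t => l y + t * β) ?_ this
    exact (Continuous.tendsto (by fun_prop) _).mono_left nhdsWithin_le_nhds
  refine ⟨(-β)⁻¹ • l, fun y => ?_⟩
  have := key y
  simp only [smul_apply, map_sub, smul_eq_mul]
  rw [← le_sub_iff_add_le', ← mul_sub, inv_mul_le_iff₀ (by linarith)]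
  linarith

variable {d : ℕ} {f : EuclideanSpace ℝ (Fin d) → ℝ}

/-- The quotients based at x itself are at least ⟨s, v⟩ and occur frequently in the filter. The
Lipschitz bound keeps the quotients bounded above, without which the real `limsup` would say
nothing. -/
lemma mem_clarkeSubdiff_of_subgradient (hf : LocallyLipschitz f) {x s : EuclideanSpace ℝ (Fin d)}
    (hs : ∀ y, f x + inner ℝ s (y - x) ≤ f y) : s ∈ clarkeSubdiff f x := by
  intro v
  refine le_limsup_of_frequently_le ?_ ?_
  · have h1 : ∃ᶠ p in 𝓝 x ×ˢ 𝓝[>] (0 : ℝ), p.1 = x := by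
      rw [Filter.frequently_iff]
      intro U hU
      obtain ⟨V, hV, W, hW, hVW⟩ := Filter.mem_prod_iff.1 hU
      obtain ⟨t, ht⟩ := Filter.nonempty_of_mem hW
      exact ⟨(x, t), hVW ⟨mem_of_mem_nhds hV, ht⟩, rfl⟩
    have h2 : ∀ᶠ p in 𝓝 x ×ˢ 𝓝[>] (0 : ℝ), 0 < p.2 :=
      Filter.tendsto_snd.eventually self_mem_nhdsWithin
    refine (h1.and_eventually h2).mono ?_
    rintro ⟨p, t⟩ ⟨rfl, ht⟩
    have := hs (p + t • v)
    rw [add_sub_cancel_left, real_inner_smul_right] at this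
    simp only at ht ⊢
    rw [le_div_iff₀ ht]
    linarith
  · obtain ⟨K, U, hU, hK⟩ := hf x
    have h1 : ∀ᶠ p in 𝓝 x ×ˢ 𝓝[>] (0 : ℝ), p.1 ∈ U := Filter.tendsto_fst.eventually hU
    have h2 : ∀ᶠ p in 𝓝 x ×ˢ 𝓝[>] (0 : ℝ), 0 < p.2 :=
      Filter.tendsto_snd.eventually self_mem_nhdsWithin
    have h3 : ∀ᶠ p : EuclideanSpace ℝ (Fin d) × ℝ in 𝓝 x ×ˢ 𝓝[>] (0 : ℝ),
        p.1 + p.2 • v ∈ U := by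
      have ht : Tendsto (fun p : EuclideanSpace ℝ (Fin d) × ℝ => p.1 + p.2 • v)
          (𝓝 x ×ˢ 𝓝[>] (0 : ℝ)) (𝓝 x) := by
        have : Tendsto (fun p : EuclideanSpace ℝ (Fin d) × ℝ => p.1 + p.2 • v)
          (𝓝 (x, (0 : ℝ))) (𝓝 (x + (0 : ℝ) • v)) :=
          Continuous.tendsto (f := fun p : EuclideanSpace ℝ (Fin d) × ℝ => p.1 + p.2 • v)
            (by fun_prop) (x, 0)
        rw [zero_smul, add_zero, nhds_prod_eq] at this
        exact this.mono_left (Filter.prod_mono le_rfl nhdsWithin_le_nhds)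
      exact ht.eventually hU
    refine ⟨K * ‖v‖, ?_⟩
    rw [Filter.eventually_map]
    filter_upwards [h1, h2, h3] with p hp1 hp2 hp3
    rw [div_le_iff₀ hp2]
    have := hK.dist_le_mul _ hp3 _ hp1
    rw [Real.dist_eq, dist_eq_norm, add_sub_cancel_left, norm_smul, Real.norm_eq_abs,
      abs_of_pos hp2] at this
    linarith [le_abs_self (f (p.1 + p.2 • v) - f p.1)]

variable {R₁ R₂ : ℝ} {m : ℕ}

lemma IsSPBWith.exists_subgradient (hf : IsSPBWith f R₁ R₂ m) (hc : ConvexOn ℝ Set.univ f)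
    (x : EuclideanSpace ℝ (Fin d)) :
    ∃ s : EuclideanSpace ℝ (Fin d), (∀ y, f x + inner ℝ s (y - x) ≤ f y) ∧
      ‖s‖ ≤ R₁ * ‖x‖ ^ m + R₂ := by
  obtain ⟨L, hL⟩ := SPB.exists_subgradient hc hf.locallyLipschitz.continuous x
  refine ⟨(InnerProductSpace.toDual ℝ _).symm L, fun y => ?_, ?_⟩
  · simpa using hL y
  · refine hf.bound x _ (mem_clarkeSubdiff_of_subgradient hf.locallyLipschitz fun y => ?_)
    simpa using hL y

/-- The subgradient is taken at the endpoint y, so convexity replaces a mean value theorem;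
exchanging x and y bounds the increment from below. -/
lemma IsSPBWith.sub_le (hf : IsSPBWith f R₁ R₂ m) (hc : ConvexOn ℝ Set.univ f)
    (x y : EuclideanSpace ℝ (Fin d)) : f y - f x ≤ (R₁ * ‖y‖ ^ m + R₂) * ‖y - x‖ := by
  obtain ⟨s, hs, hb⟩ := hf.exists_subgradient hc y
  have h1 := hs x
  have h2 : -inner ℝ s (x - y) ≤ ‖s‖ * ‖y - x‖ := by
    rw [← inner_neg_right, neg_sub]
    exact real_inner_le_norm _ _
  have h3 : ‖s‖ * ‖y - x‖ ≤ (R₁ * ‖y‖ ^ m + R₂) * ‖y - x‖ := by gcongr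
  linarith

/-- The growth bound for increments of a convex function with polynomially bounded
subdifferential. -/
lemma IsSPBWith.abs_sub_le (hf : IsSPBWith f R₁ R₂ m) (hc : ConvexOn ℝ Set.univ f)
    (x w : EuclideanSpace ℝ (Fin d)) :
    |f (x + w) - f x| ≤ (2 ^ (m - 1) * R₁ * (‖x‖ ^ m + ‖w‖ ^ m) + R₂) * ‖w‖ := by
  have hR := hf.R₁_nonneg
  have h2 : (1 : ℝ) ≤ 2 ^ (m - 1) := one_le_pow₀ (by norm_num)
  have hp : ‖x + w‖ ^ m ≤ 2 ^ (m - 1) * (‖x‖ ^ m + ‖w‖ ^ m) :=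
    (pow_le_pow_left₀ (norm_nonneg _) (norm_add_le x w) m).trans
      (add_pow_le (norm_nonneg _) (norm_nonneg _) m)
  have hx : ‖x‖ ^ m ≤ 2 ^ (m - 1) * (‖x‖ ^ m + ‖w‖ ^ m) := by
    have : 0 ≤ ‖w‖ ^ m := by positivity
    have : 0 ≤ ‖x‖ ^ m := by positivity
    nlinarith
  rw [abs_le']
  constructor
  · refine (hf.sub_le hc x (x + w)).trans ?_
    rw [add_sub_cancel_left]
    gcongr ?_ * _
    have := mul_le_mul_of_nonneg_left hp hR
    linarith
  · rw [neg_sub]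
    refine (hf.sub_le hc (x + w) x).trans ?_
    rw [show x - (x + w) = -w by abel, norm_neg]
    gcongr ?_ * _
    have := mul_le_mul_of_nonneg_left hx hR
    linarith

end Convex

/-! ### The Gaussian smoothing and the random direction. -/

section Smoothing

variable {d : ℕ} {f : EuclideanSpace ℝ (Fin d) → ℝ} {R₁ R₂ σ : ℝ} {m : ℕ}

/-- The Gaussian smoothing of `f` with parameter `σ`. -/
noncomputable def gaussSmooth (f : EuclideanSpace ℝ (Fin d) → ℝ) (σ : ℝ)
    (x : EuclideanSpace ℝ (Fin d)) : ℝ :=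
  ∫ u, f (x + σ • u) ∂(stdGaussian (EuclideanSpace ℝ (Fin d)))

lemma two_zpow_sub_one (hm : 1 ≤ m) : (2 : ℝ) ^ ((m : ℤ) - 1) = 2 ^ (m - 1) := by
  rw [← zpow_natCast]; congr 1; omega

/-- Polynomial growth is relaxed to the exponential growth required by
`integral_mul_inner_stdGaussian_ge`. -/
lemma IsSPBWith.abs_comp_le_exp (hf : IsSPBWith f R₁ R₂ m) (hc : ConvexOn ℝ Set.univ f)
    (hσ : 0 < σ) (x : EuclideanSpace ℝ (Fin d)) :
    ∃ C, ∀ u, |f (x + σ • u)| ≤ C * Real.exp (σ * ‖u‖) := by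
  have hR := hf.R₁_nonneg
  have hR2 := hf.R₂_pos
  refine ⟨|f x| + (2 ^ (m - 1) * R₁ * ‖x‖ ^ m + R₂) + 2 ^ (m - 1) * R₁ * (m + 1).factorial,
    fun u => ?_⟩
  have h1 := hf.abs_sub_le hc x (σ • u)
  have hn : ‖σ • u‖ = σ * ‖u‖ := by rw [norm_smul, Real.norm_eq_abs, abs_of_pos hσ]
  rw [hn] at h1
  set r := σ * ‖u‖
  have hr : 0 ≤ r := by positivity
  have e1 : 1 ≤ Real.exp r := Real.one_le_exp hr
  have e2 : r ≤ Real.exp r := by linarith [Real.add_one_le_exp r]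
  have e3 : r ^ (m + 1) ≤ (m + 1).factorial * Real.exp r := by
    have := Real.pow_div_factorial_le_exp r hr (m + 1)
    rw [div_le_iff₀ (by positivity)] at this
    linarith
  have h2 : |f (x + σ • u)| ≤ |f x| + |f (x + σ • u) - f x| := by
    have := abs_add_le (f x) (f (x + σ • u) - f x)
    rwa [add_sub_cancel] at this
  calc |f (x + σ • u)| ≤ |f x| + (2 ^ (m - 1) * R₁ * (‖x‖ ^ m + r ^ m) + R₂) * r := by linarith
    _ = |f x| * 1 + (2 ^ (m - 1) * R₁ * ‖x‖ ^ m + R₂) * r + 2 ^ (m - 1) * R₁ * r ^ (m + 1) := by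
        ring
    _ ≤ |f x| * Real.exp r + (2 ^ (m - 1) * R₁ * ‖x‖ ^ m + R₂) * Real.exp r +
          2 ^ (m - 1) * R₁ * ((m + 1).factorial * Real.exp r) := by gcongr
    _ = _ := by ring

lemma IsSPBWith.measurable (hf : IsSPBWith f R₁ R₂ m) : Measurable f :=
  hf.locallyLipschitz.continuous.measurable

lemma IsSPBWith.integrable_comp (hf : IsSPBWith f R₁ R₂ m) (hc : ConvexOn ℝ Set.univ f)
    (hσ : 0 < σ) (x : EuclideanSpace ℝ (Fin d)) :
    Integrable (fun u => f (x + σ • u)) (stdGaussian (EuclideanSpace ℝ (Fin d))) := by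
  obtain ⟨C, hC⟩ := hf.abs_comp_le_exp hc hσ x
  have := hf.measurable
  exact integrable_of_abs_le_exp_norm (by fun_prop) hC

/-- Jensen's inequality: the linear term of a subgradient at x has Gaussian mean zero. -/
lemma IsSPBWith.le_gaussSmooth (hf : IsSPBWith f R₁ R₂ m) (hc : ConvexOn ℝ Set.univ f)
    (hσ : 0 < σ) (x : EuclideanSpace ℝ (Fin d)) : f x ≤ gaussSmooth f σ x := by
  obtain ⟨s, hs, -⟩ := hf.exists_subgradient hc x
  have hz : ∫ u, inner ℝ s u ∂(stdGaussian (EuclideanSpace ℝ (Fin d))) = 0 :=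
    integral_strongDual_stdGaussian (innerSL ℝ s)
  have hi : Integrable (fun u => inner ℝ s u) (stdGaussian (EuclideanSpace ℝ (Fin d))) :=
    (IsGaussian.integrable_id (μ := stdGaussian (EuclideanSpace ℝ (Fin d)))).const_inner s
  have h1 : ∫ u, (f x + σ * inner ℝ s u) ∂(stdGaussian (EuclideanSpace ℝ (Fin d)))
      ≤ gaussSmooth f σ x := by
    refine integral_mono ((integrable_const _).add (hi.const_mul _))
      (hf.integrable_comp hc hσ x) fun u => ?_
    have := hs (x + σ • u)
    rwa [add_sub_cancel_left, real_inner_smul_right] at this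
  rw [integral_add (integrable_const _) (hi.const_mul _), integral_const_mul, hz] at h1
  simpa using h1

/-- The two terms of 𝓜 come from the moments of order 1 and m + 1 in the integrated increment bound.
-/
lemma IsSPBWith.gaussSmooth_le (hf : IsSPBWith f R₁ R₂ m) (hc : ConvexOn ℝ Set.univ f)
    (hm : 1 ≤ m) (hσ : 0 < σ) (x : EuclideanSpace ℝ (Fin d)) :
    gaussSmooth f σ x ≤ f x + scriptM R₁ R₂ m σ x * σ := by
  have hR := hf.R₁_nonneg
  have hR2 := hf.R₂_pos
  set a : ℝ := 2 ^ (m - 1) * R₁ with ha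
  have ha0 : 0 ≤ a := by positivity
  have i1 : Integrable (fun u : EuclideanSpace ℝ (Fin d) => ‖u‖)
      (stdGaussian (EuclideanSpace ℝ (Fin d))) := by
    simpa using integrable_norm_pow_stdGaussian (d := d) 1
  have i2 := integrable_norm_pow_stdGaussian (d := d) (m + 1)
  have h1 : gaussSmooth f σ x ≤ ∫ u, (f x + (((a * ‖x‖ ^ m + R₂) * σ) * ‖u‖ +
      (a * σ ^ m * σ) * ‖u‖ ^ (m + 1))) ∂(stdGaussian (EuclideanSpace ℝ (Fin d))) := by
    refine integral_mono (hf.integrable_comp hc hσ x)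
      ((integrable_const _).add ((i1.const_mul _).fun_add (i2.const_mul _))) fun u => ?_
    have := (le_abs_self _).trans (hf.abs_sub_le hc x (σ • u))
    rw [norm_smul, Real.norm_eq_abs, abs_of_pos hσ, ← ha] at this
    have e : (a * (‖x‖ ^ m + (σ * ‖u‖) ^ m) + R₂) * (σ * ‖u‖) = ((a * ‖x‖ ^ m + R₂) * σ) * ‖u‖ +
      (a * σ ^ m * σ) * ‖u‖ ^ (m + 1) := by ring
    rw [e] at this
    simp only
    linarith
  rw [integral_add (integrable_const _) ((i1.const_mul _).fun_add (i2.const_mul _)),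
    integral_add (i1.const_mul _) (i2.const_mul _), integral_const_mul, integral_const_mul] at h1
  have b1 := integral_norm_stdGaussian_le (d := d)
  have b2 := integral_norm_pow_stdGaussian_le (d := d) (p := m + 1) (by omega)
  refine h1.trans ?_
  rw [scriptM, two_zpow_sub_one hm, ← ha]
  simp only [integral_const, probReal_univ, one_smul]
  push_cast at b2
  have c1 : (a * ‖x‖ ^ m + R₂) * σ * ∫ u, ‖u‖ ∂(stdGaussian (EuclideanSpace ℝ (Fin d)))
    ≤ (a * ‖x‖ ^ m + R₂) * σ * √(d : ℝ) := by gcongr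
  have c2 := mul_le_mul_of_nonneg_left b2 (by positivity : 0 ≤ a * σ ^ m * σ)
  linarith

lemma IsSPBWith.convexOn_gaussSmooth (hf : IsSPBWith f R₁ R₂ m) (hc : ConvexOn ℝ Set.univ f)
    (hσ : 0 < σ) : ConvexOn ℝ Set.univ (gaussSmooth f σ) := by
  refine ⟨convex_univ, fun x _ y _ a b ha hb hab => ?_⟩
  have ix := hf.integrable_comp hc hσ x
  have iy := hf.integrable_comp hc hσ y
  simp only [gaussSmooth, smul_eq_mul]
  rw [← integral_const_mul, ← integral_const_mul, ← integral_add (ix.const_mul _) (iy.const_mul _)]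
  refine integral_mono (hf.integrable_comp hc hσ _) ((ix.const_mul _).add (iy.const_mul _))
    fun u => ?_
  have := hc.2 (Set.mem_univ (x + σ • u)) (Set.mem_univ (y + σ • u)) ha hb hab
  have e : a • (x + σ • u) + b • (y + σ • u) = a • x + b • y + σ • u := by
    rw [smul_add, smul_add, add_add_add_comm, ← add_smul, hab, one_smul]
  rw [e] at this
  simpa using this

lemma IsSPBWith.continuous_gaussSmooth (hf : IsSPBWith f R₁ R₂ m) (hc : ConvexOn ℝ Set.univ f)
    (hσ : 0 < σ) : Continuous (gaussSmooth f σ) :=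
  (hf.convexOn_gaussSmooth hc hσ).locallyLipschitz.continuous

/-- The random direction is, on average, a subgradient of the Gaussian smoothing. -/
lemma IsSPBWith.integral_inner_gsDir_ge (hf : IsSPBWith f R₁ R₂ m) (hc : ConvexOn ℝ Set.univ f)
    (hσ : 0 < σ) (x w : EuclideanSpace ℝ (Fin d)) :
    gaussSmooth f σ x - gaussSmooth f σ (x - w) ≤
      ∫ u, inner ℝ (gsDir f σ x u) w ∂(stdGaussian (EuclideanSpace ℝ (Fin d))) := by
  obtain ⟨C, hC⟩ := hf.abs_comp_le_exp hc hσ x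
  have hfm := hf.measurable
  have hcF : ConvexOn ℝ Set.univ (fun u => f (x + σ • u)) := by
    refine ⟨convex_univ, fun u _ v _ a b ha hb hab => ?_⟩
    have := hc.2 (Set.mem_univ (x + σ • u)) (Set.mem_univ (x + σ • v)) ha hb hab
    have e : a • (x + σ • u) + b • (x + σ • v) = x + σ • (a • u + b • v) := by
      rw [smul_add, smul_add, add_add_add_comm, ← add_smul, hab, one_smul, smul_add,
        smul_comm a σ, smul_comm b σ]
    rw [e] at this
    exact this
  obtain ⟨hI, hle⟩ := integral_mul_inner_stdGaussian_ge (F := fun u => f (x + σ • u))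
    (by fun_prop) hcF hσ.le hC (σ⁻¹ • w)
  -- The centring term f(x)u of the direction contributes nothing on average.
  have hz : ∫ u, inner ℝ (σ⁻¹ • w) u ∂(stdGaussian (EuclideanSpace ℝ (Fin d))) = 0 :=
    integral_strongDual_stdGaussian (innerSL ℝ (σ⁻¹ • w))
  have hi : Integrable (fun u => inner ℝ (σ⁻¹ • w) u)
      (stdGaussian (EuclideanSpace ℝ (Fin d))) :=
    (IsGaussian.integrable_id (μ := stdGaussian (EuclideanSpace ℝ (Fin d)))).const_inner _
  have e1 : ∀ u, inner ℝ (gsDir f σ x u) w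
      = f (x + σ • u) * inner ℝ (σ⁻¹ • w) u - f x * inner ℝ (σ⁻¹ • w) u := fun u => by
    rw [gsDir, real_inner_smul_left, real_inner_smul_left, real_inner_comm]
    ring
  simp_rw [e1]
  rw [integral_sub hI (hi.const_mul _), integral_const_mul, hz, mul_zero, sub_zero]
  have e2 : ∀ u, x + σ • (u - σ⁻¹ • w) = x - w + σ • u := fun u => by
    rw [smul_sub, smul_inv_smul₀ hσ.ne']; abel
  simp_rw [e2] at hle
  exact hle

/-- A bound on the squared norm of the random direction, with the base point separated from the
Gaussian vector. -/
lemma IsSPBWith.norm_sq_gsDir_le (hf : IsSPBWith f R₁ R₂ m) (hc : ConvexOn ℝ Set.univ f)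
    (hσ : 0 < σ) (x u : EuclideanSpace ℝ (Fin d)) :
    ‖gsDir f σ x u‖ ^ 2 ≤ 3 * ((2 ^ (m - 1) * R₁) ^ 2 * ‖u‖ ^ 4 * (‖x‖ ^ m) ^ 2 +
      (R₂ ^ 2 * ‖u‖ ^ 4 + (2 ^ (m - 1) * R₁) ^ 2 * σ ^ (m * 2) * ‖u‖ ^ (2 * m + 4))) := by
  have hR := hf.R₁_nonneg
  have hR2 := hf.R₂_pos
  set a : ℝ := 2 ^ (m - 1) * R₁ with ha
  have h1 := hf.abs_sub_le hc x (σ • u)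
  rw [norm_smul, Real.norm_eq_abs, abs_of_pos hσ, ← ha] at h1
  have h2 : ‖gsDir f σ x u‖ ≤ (a * (‖x‖ ^ m + (σ * ‖u‖) ^ m) + R₂) * ‖u‖ ^ 2 := by
    rw [gsDir, norm_smul, Real.norm_eq_abs, abs_mul, abs_of_pos (by positivity)]
    calc _ ≤ 1 / σ * ((a * (‖x‖ ^ m + (σ * ‖u‖) ^ m) + R₂) * (σ * ‖u‖)) * ‖u‖ := by gcongr
      _ = _ := by field_simp
  calc ‖gsDir f σ x u‖ ^ 2 ≤ ((a * (‖x‖ ^ m + (σ * ‖u‖) ^ m) + R₂) * ‖u‖ ^ 2) ^ 2 := by gcongr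
    _ = (a * ‖x‖ ^ m + R₂ + a * (σ * ‖u‖) ^ m) ^ 2 * ‖u‖ ^ 4 := by ring
    -- The inequality (p + q + r)² ≤ 3(p² + q² + r²) is the source of the 3 in ℋ.
    _ ≤ 3 * ((a * ‖x‖ ^ m) ^ 2 + R₂ ^ 2 + (a * (σ * ‖u‖) ^ m) ^ 2) * ‖u‖ ^ 4 := by
        gcongr
        nlinarith [sq_nonneg (a * ‖x‖ ^ m - R₂), sq_nonneg (a * ‖x‖ ^ m - a * (σ * ‖u‖) ^ m),
          sq_nonneg (R₂ - a * (σ * ‖u‖) ^ m)]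
    _ = _ := by ring

/-- The moments of order 4 and 2m + 4 give a bound A‖x‖^(2m) + B, and ℋ is three times max(A, B). -/
lemma IsSPBWith.integral_norm_sq_gsDir_le (hf : IsSPBWith f R₁ R₂ m)
    (hc : ConvexOn ℝ Set.univ f) (hm : 1 ≤ m) (hσ : 0 < σ) (x : EuclideanSpace ℝ (Fin d)) :
    ∫ u, ‖gsDir f σ x u‖ ^ 2 ∂(stdGaussian (EuclideanSpace ℝ (Fin d)))
      ≤ scriptH d R₁ R₂ m σ 2 * (‖x‖ ^ m + 1) ^ 2 := by
  have hR := hf.R₁_nonneg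
  have hR2 := hf.R₂_pos
  have hb := hf.norm_sq_gsDir_le hc hσ x
  set a : ℝ := 2 ^ (m - 1) * R₁ with ha
  have i1 := integrable_norm_pow_stdGaussian (d := d) 4
  have i2 := integrable_norm_pow_stdGaussian (d := d) (2 * m + 4)
  have j1 := (i1.const_mul (a ^ 2)).mul_const ((‖x‖ ^ m) ^ 2)
  have j2 := i1.const_mul (R₂ ^ 2)
  have j3 := i2.const_mul (a ^ 2 * σ ^ (m * 2))
  have h1 := integral_mono_of_nonneg (Eventually.of_forall fun u => by positivity)
    ((j1.fun_add (j2.fun_add j3)).const_mul 3) (Eventually.of_forall hb)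
  refine h1.trans ?_
  rw [integral_const_mul, integral_add j1 (j2.fun_add j3)]
  rw [integral_add j2 j3, integral_mul_const, integral_const_mul,
    integral_const_mul, integral_const_mul]
  have b1 := integral_norm_pow_stdGaussian_le (d := d) (p := 4) (by omega)
  have b2 := integral_norm_pow_stdGaussian_le (d := d) (p := 2 * m + 4) (by omega)
  have e1 : (((4 : ℕ) : ℝ) + d) ^ (((4 : ℕ) : ℝ) / 2) = (2 * ((2 : ℕ) : ℝ) + d) ^ 2 := by
    rw [← Real.rpow_natCast]; norm_num
  have e2 : (((2 * m + 4 : ℕ) : ℝ) + d) ^ (((2 * m + 4 : ℕ) : ℝ) / 2)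
      = (((m : ℝ) + 2) * (2 : ℕ) + d) ^ (((m : ℝ) + 2) * (2 : ℕ) / 2) := by
    push_cast; congr 1 <;> ring
  have e3 : (2 : ℝ) ^ (((m : ℤ) - 1) * (2 : ℕ)) * R₁ ^ 2 = a ^ 2 := by
    rw [zpow_mul, two_zpow_sub_one hm, ha, mul_pow]; norm_cast
  rw [e1] at b1
  rw [e2] at b2
  rw [scriptH, if_neg two_ne_zero, e3, pow_one, mul_assoc (3 : ℝ)]
  refine mul_le_mul_of_nonneg_left ?_ (by norm_num)
  set A := a ^ 2 * (2 * ((2 : ℕ) : ℝ) + d) ^ 2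
  set B := R₂ ^ 2 * (2 * ((2 : ℕ) : ℝ) + d) ^ 2 + a ^ 2 * σ ^ (m * 2) *
    (((m : ℝ) + 2) * (2 : ℕ) + d) ^ (((m : ℝ) + 2) * (2 : ℕ) / 2)
  have hA : 0 ≤ A := by positivity
  calc _ ≤ A * (‖x‖ ^ m) ^ 2 + B := by simp only [A, B]; gcongr
    _ ≤ max A B * (‖x‖ ^ m) ^ 2 + max A B := by
        gcongr
        · exact le_max_left _ _
        · exact le_max_right _ _
    _ ≤ max A B * (‖x‖ ^ m + 1) ^ 2 := by
        have : 0 ≤ max A B := hA.trans (le_max_left _ _)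
        have : 0 ≤ max A B * ‖x‖ ^ m := by positivity
        linarith

lemma scriptM_nonneg (hR₁ : 0 ≤ R₁) (hR₂ : 0 ≤ R₂) (hσ : 0 ≤ σ) (x : EuclideanSpace ℝ (Fin d)) :
    0 ≤ scriptM R₁ R₂ m σ x := by
  unfold scriptM; positivity

lemma bddAbove_levNorms (hl : LevelBounded f) (xs : EuclideanSpace ℝ (Fin d)) :
    BddAbove (levNorms f R₁ R₂ m σ xs) := by
  obtain ⟨C, hC⟩ := (hl (f xs + scriptM R₁ R₂ m σ xs * σ)).exists_norm_le
  refine ⟨C, ?_⟩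
  rintro _ ⟨x, hx, rfl⟩
  exact hC x hx

/-- The Gaussian smoothing has a minimizer over `Ω`, and its norm is at most `C_lev`. -/
lemma IsSPBWith.exists_isMinOn_gaussSmooth (hf : IsSPBWith f R₁ R₂ m)
    (hc : ConvexOn ℝ Set.univ f) (hl : LevelBounded f) (hm : 1 ≤ m) (hσ : 0 < σ)
    {Ω : Set (EuclideanSpace ℝ (Fin d))} (hΩ : IsClosed Ω) {xs : EuclideanSpace ℝ (Fin d)}
    (hxs : xs ∈ Ω) :
    ∃ z ∈ Ω, (∀ y ∈ Ω, gaussSmooth f σ z ≤ gaussSmooth f σ y) ∧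
      ‖z‖ ≤ Clev f R₁ R₂ m σ xs := by
  set α := f xs + scriptM R₁ R₂ m σ xs * σ
  have hM := scriptM_nonneg (m := m) hf.R₁_nonneg hf.R₂_pos.le hσ.le xs
  have hcomp : IsCompact (Ω ∩ {x | f x ≤ α}) := by
    refine Metric.isCompact_of_isClosed_isBounded
      (hΩ.inter (isClosed_le hf.locallyLipschitz.continuous continuous_const))
      ((hl α).subset Set.inter_subset_right)
  have hmem : xs ∈ Ω ∩ {x | f x ≤ α} :=
    ⟨hxs, le_add_of_nonneg_right (mul_nonneg hM hσ.le)⟩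
  obtain ⟨z, hz, hmin⟩ := hcomp.exists_isMinOn ⟨xs, hmem⟩
    (hf.continuous_gaussSmooth hc hσ).continuousOn
  refine ⟨z, hz.1, fun y hy => ?_, le_csSup (bddAbove_levNorms hl xs) ⟨z, hz.2, rfl⟩⟩
  by_cases hya : f y ≤ α
  · exact hmin ⟨hy, hya⟩
  -- Outside the sublevel set, f_σ ≥ f > α ≥ f_σ(x*), so minimizing over the compact part suffices.
  · calc gaussSmooth f σ z ≤ gaussSmooth f σ xs := hmin hmem
      _ ≤ α := hf.gaussSmooth_le hc hm hσ xs
      _ ≤ f y := (not_le.1 hya).le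
      _ ≤ _ := hf.le_gaussSmooth hc hσ y

end Smoothing

/-! ### Projection onto a closed convex set. -/

section Projection

variable {d : ℕ} {S : Set (EuclideanSpace ℝ (Fin d))}

lemma IsProj.inner_le_zero (hS : Convex ℝ S) {y p : EuclideanSpace ℝ (Fin d)} (h : IsProj S y p) :
    ∀ w ∈ S, inner ℝ (y - p) (w - p) ≤ 0 := by
  have : Nonempty S := ⟨⟨p, h.1⟩⟩
  refine (norm_eq_iInf_iff_real_inner_le_zero hS h.1).1 (le_antisymm ?_ ?_)
  · exact le_ciInf fun w => h.2 w w.2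
  · exact ciInf_le (f := fun w : S => ‖y - w‖) ⟨0, by rintro _ ⟨w, rfl⟩; exact norm_nonneg _⟩ ⟨p, h.1⟩

lemma IsProj.norm_sub_le (hS : Convex ℝ S) {y p z q : EuclideanSpace ℝ (Fin d)}
    (h : IsProj S y p) (h' : IsProj S z q) : ‖p - q‖ ≤ ‖y - z‖ := by
  have h1 := h.inner_le_zero hS q h'.1
  have h2 := h'.inner_le_zero hS p h.1
  have h3 : ‖p - q‖ ^ 2 ≤ inner ℝ (y - z) (p - q) := by
    have e1 : inner ℝ (y - p) (q - p) = -inner ℝ (y - p) (p - q) := by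
      rw [← inner_neg_right, neg_sub]
    have e2 : y - z = (y - p) + (p - q) - (z - q) := by abel
    rw [e2, inner_sub_left, inner_add_left, real_inner_self_eq_norm_sq]
    linarith
  have h4 := real_inner_le_norm (y - z) (p - q)
  rcases (norm_nonneg (p - q)).eq_or_lt with h0 | h0
  · rw [← h0]; exact norm_nonneg _
  · nlinarith

lemma isProj_self {y : EuclideanSpace ℝ (Fin d)} (hy : y ∈ S) : IsProj S y y :=
  ⟨hy, fun z _ => by simp⟩

/-- The projection onto a nonempty closed convex set is a well-defined continuous map. -/
lemma exists_continuous_proj (hne : S.Nonempty) (hcl : IsClosed S) (hS : Convex ℝ S) :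
    ∃ pr : EuclideanSpace ℝ (Fin d) → EuclideanSpace ℝ (Fin d), Continuous pr ∧
      ∀ y p, IsProj S y p → p = pr y := by
  have hex : ∀ y, ∃ p, IsProj S y p := fun y => by
    obtain ⟨p, hp, h⟩ := exists_norm_eq_iInf_of_complete_convex hne hcl.isComplete hS y
    refine ⟨p, hp, fun z hz => ?_⟩
    rw [h]
    exact ciInf_le (f := fun w : S => ‖y - w‖)
      ⟨0, by rintro _ ⟨w, rfl⟩; exact norm_nonneg _⟩ ⟨z, hz⟩
  choose pr hpr using hex
  refine ⟨pr, ?_, fun y p hp => ?_⟩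
  · refine LipschitzWith.continuous (K := 1) (LipschitzWith.of_dist_le_mul fun y z => ?_)
    simpa [dist_eq_norm] using (hpr y).norm_sub_le hS (hpr z)
  · have := hp.norm_sub_le hS (hpr y)
    rw [sub_self, norm_zero] at this
    exact sub_eq_zero.1 (norm_le_zero_iff.1 this)

end Projection

/-! ### The one-step inequality. -/

section Step

variable {d : ℕ} {Ξ : Type*} [MeasurableSpace Ξ] {P : Measure Ξ} [IsProbabilityMeasure P]
  {f : EuclideanSpace ℝ (Fin d) → ℝ} {R₁ R₂ σ : ℝ} {m : ℕ}

/-- Freezing lemma: an independent standard Gaussian vector can be integrated out first. -/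
lemma integral_comp_indep {X U : Ξ → EuclideanSpace ℝ (Fin d)} (hX : Measurable X)
    (hU : Measurable U) (hXU : IndepFun X U P)
    (hlaw : P.map U = stdGaussian (EuclideanSpace ℝ (Fin d)))
    {h : EuclideanSpace ℝ (Fin d) × EuclideanSpace ℝ (Fin d) → ℝ} (hh : Measurable h)
    (hi : Integrable (fun ω => h (X ω, U ω)) P) :
    Integrable (fun ω => ∫ u, h (X ω, u) ∂(stdGaussian (EuclideanSpace ℝ (Fin d)))) P ∧
    ∫ ω, h (X ω, U ω) ∂P
      = ∫ ω, ∫ u, h (X ω, u) ∂(stdGaussian (EuclideanSpace ℝ (Fin d))) ∂P := by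
  have hmap := (indepFun_iff_map_prod_eq_prod_map_map hX.aemeasurable hU.aemeasurable).1 hXU
  rw [hlaw] at hmap
  have hXU' : Measurable fun ω => (X ω, U ω) := hX.prodMk hU
  have : IsProbabilityMeasure (P.map X) := Measure.isProbabilityMeasure_map hX.aemeasurable
  have hi' : Integrable h ((P.map X).prod (stdGaussian (EuclideanSpace ℝ (Fin d)))) := by
    rw [← hmap]
    exact (integrable_map_measure hh.aestronglyMeasurable hXU'.aemeasurable).2 hi
  refine ⟨hi'.integral_prod_left.comp_measurable hX, ?_⟩
  rw [← integral_map (f := h) hXU'.aemeasurable hh.aestronglyMeasurable, hmap,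
    integral_prod h hi', integral_map hX.aemeasurable hi'.integral_prod_left.aestronglyMeasurable]

lemma integrable_norm_sub_sq {X : Ξ → EuclideanSpace ℝ (Fin d)} (hX : Measurable X)
    (hi : Integrable (fun ω => ‖X ω‖ ^ 2) P) (y : EuclideanSpace ℝ (Fin d)) :
    Integrable (fun ω => ‖X ω - y‖ ^ 2) P := by
  refine ((hi.const_mul 2).add (integrable_const (2 * ‖y‖ ^ 2))).mono'
    (Measurable.aestronglyMeasurable (by fun_prop)) (Eventually.of_forall fun ω => ?_)
  rw [Real.norm_eq_abs, abs_of_nonneg (by positivity)]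
  have := norm_sub_le (X ω) y
  simp only [Pi.add_apply]
  nlinarith [sq_nonneg (‖X ω‖ - ‖y‖), norm_nonneg (X ω - y)]

/-- The one-step estimate for the projected random descent. -/
lemma IsSPBWith.integral_norm_sq_step_le (hf : IsSPBWith f R₁ R₂ m)
    (hc : ConvexOn ℝ Set.univ f) (hm : 1 ≤ m) (hσ : 0 < σ)
    {Ω : Set (EuclideanSpace ℝ (Fin d))} (hΩ : Convex ℝ Ω)
    {X U X' : Ξ → EuclideanSpace ℝ (Fin d)} (hX : Measurable X) (hU : Measurable U)
    (hX' : Measurable X') (hXU : IndepFun X U P)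
    (hlaw : P.map U = stdGaussian (EuclideanSpace ℝ (Fin d)))
    (hXΩ : ∀ ω, X ω ∈ Ω) (hXi : Integrable (fun ω => ‖X ω‖ ^ 2) P)
    {τ : ℝ} (hτ : 0 ≤ τ)
    (hstep : ∀ ω, IsProj Ω (X ω - (τ / (‖X ω‖ ^ m + 1)) • gsDir f σ (X ω) (U ω)) (X' ω))
    {y : EuclideanSpace ℝ (Fin d)} (hy : y ∈ Ω) {φ : EuclideanSpace ℝ (Fin d) → ℝ}
    (hφm : Measurable φ) {B : ℝ} (hφB : ∀ x ∈ Ω, -B ≤ φ x)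
    (hφ : ∀ x ∈ Ω, φ x ≤ gaussSmooth f σ x - gaussSmooth f σ y) :
    Integrable (fun ω => ‖X' ω‖ ^ 2) P ∧
    Integrable (fun ω => φ (X ω) / (‖X ω‖ ^ m + 1)) P ∧
    ∫ ω, ‖X' ω - y‖ ^ 2 ∂P ≤ ∫ ω, ‖X ω - y‖ ^ 2 ∂P
      - 2 * τ * ∫ ω, φ (X ω) / (‖X ω‖ ^ m + 1) ∂P + τ ^ 2 * scriptH d R₁ R₂ m σ 2 := by
  have hR := hf.R₁_nonneg
  have hR2 := hf.R₂_pos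
  have hfm := hf.measurable
  have hgm : Measurable fun p : EuclideanSpace ℝ (Fin d) × EuclideanSpace ℝ (Fin d) =>
      gsDir f σ p.1 p.2 := by
    unfold gsDir; fun_prop
  have hW : ∀ x : EuclideanSpace ℝ (Fin d), 1 ≤ ‖x‖ ^ m + 1 := fun x =>
    le_add_of_nonneg_left (by positivity)
  have hW0 : ∀ x : EuclideanSpace ℝ (Fin d), 0 < ‖x‖ ^ m + 1 := fun x => by positivity
  let Q : EuclideanSpace ℝ (Fin d) × EuclideanSpace ℝ (Fin d) → ℝ := fun p =>
    (‖p.1‖ ^ m + 1)⁻¹ * inner ℝ (gsDir f σ p.1 p.2) (p.1 - y)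
  let V : EuclideanSpace ℝ (Fin d) × EuclideanSpace ℝ (Fin d) → ℝ := fun p =>
    ((‖p.1‖ ^ m + 1) ^ 2)⁻¹ * ‖gsDir f σ p.1 p.2‖ ^ 2
  have hQm : Measurable Q := by fun_prop
  have hVm : Measurable V := by fun_prop
  have hV0 : ∀ p, 0 ≤ V p := fun p => by positivity
  set a : ℝ := 2 ^ (m - 1) * R₁ with ha
  -- After normalisation the bound depends on u alone, so no high moments of `X` are needed.
  have hVb : ∀ x u, V (x, u) ≤ 3 * (a ^ 2 * ‖u‖ ^ 4 +
      (R₂ ^ 2 * ‖u‖ ^ 4 + a ^ 2 * σ ^ (m * 2) * ‖u‖ ^ (2 * m + 4))) := fun x u => by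
    simp only [V]
    rw [inv_mul_le_iff₀ (by positivity)]
    refine (hf.norm_sq_gsDir_le hc hσ x u).trans ?_
    rw [← ha]
    have h1 : (‖x‖ ^ m) ^ 2 ≤ (‖x‖ ^ m + 1) ^ 2 := by gcongr; linarith
    have h2 : 1 ≤ (‖x‖ ^ m + 1) ^ 2 := one_le_pow₀ (hW x)
    have h3 := mul_le_mul_of_nonneg_left h1 (by positivity : 0 ≤ a ^ 2 * ‖u‖ ^ 4)
    have h4 := mul_le_mul_of_nonneg_left h2 (by positivity :
      0 ≤ R₂ ^ 2 * ‖u‖ ^ 4 + a ^ 2 * σ ^ (m * 2) * ‖u‖ ^ (2 * m + 4))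
    linarith
  have hUpow : ∀ p : ℕ, Integrable (fun ω => ‖U ω‖ ^ p) P := fun p => by
    have := integrable_norm_pow_stdGaussian (d := d) p
    rw [← hlaw] at this
    exact this.comp_measurable hU
  have hVi : Integrable (fun ω => V (X ω, U ω)) P := by
    refine ((((hUpow 4).const_mul (a ^ 2)).fun_add (((hUpow 4).const_mul (R₂ ^ 2)).fun_add
      ((hUpow (2 * m + 4)).const_mul (a ^ 2 * σ ^ (m * 2))))).const_mul 3).mono'
      (hVm.comp (hX.prodMk hU)).aestronglyMeasurable (Eventually.of_forall fun ω => ?_)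
    rw [Real.norm_eq_abs, abs_of_nonneg (hV0 _)]
    exact hVb _ _
  have hXy := integrable_norm_sub_sq hX hXi y
  -- Dominated through |Q| ≤ ‖X - y‖² + V, which uses only second moments of `X`.
  have hQi : Integrable (fun ω => Q (X ω, U ω)) P := by
    refine (hXy.fun_add hVi).mono' (hQm.comp (hX.prodMk hU)).aestronglyMeasurable
      (Eventually.of_forall fun ω => ?_)
    simp only [Q, V, Real.norm_eq_abs, abs_mul, abs_of_pos (inv_pos.2 (hW0 (X ω)))]
    have h1 := abs_real_inner_le_norm (gsDir f σ (X ω) (U ω)) (X ω - y)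
    have h2 := mul_le_mul_of_nonneg_left h1 (inv_pos.2 (hW0 (X ω))).le
    refine h2.trans ?_
    rw [← inv_pow, ← mul_pow]
    set b := (‖X ω‖ ^ m + 1)⁻¹ * ‖gsDir f σ (X ω) (U ω)‖
    rw [← mul_assoc]
    nlinarith [sq_nonneg (b - ‖X ω - y‖), sq_nonneg b, sq_nonneg ‖X ω - y‖]
  obtain ⟨hQi', hQe⟩ := integral_comp_indep hX hU hXU hlaw hQm hQi
  obtain ⟨hVi', hVe⟩ := integral_comp_indep hX hU hXU hlaw hVm hVi
  have hVle : ∫ ω, V (X ω, U ω) ∂P ≤ scriptH d R₁ R₂ m σ 2 := by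
    rw [hVe]
    calc _ ≤ ∫ _, scriptH d R₁ R₂ m σ 2 ∂P := by
          refine integral_mono hVi' (integrable_const _) fun ω => ?_
          simp only [V]
          rw [integral_const_mul, inv_mul_le_iff₀ (by positivity), mul_comm]
          exact hf.integral_norm_sq_gsDir_le hc hm hσ _
      _ = _ := by simp
  have hφle : ∀ ω, φ (X ω) / (‖X ω‖ ^ m + 1)
      ≤ ∫ u, Q (X ω, u) ∂(stdGaussian (EuclideanSpace ℝ (Fin d))) := fun ω => by
    simp only [Q]
    rw [integral_const_mul, div_eq_inv_mul]
    refine mul_le_mul_of_nonneg_left ?_ (inv_pos.2 (hW0 _)).le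
    have := hf.integral_inner_gsDir_ge hc hσ (X ω) (X ω - y)
    rw [sub_sub_cancel] at this
    exact (hφ _ (hXΩ ω)).trans this
  -- Bounded above by the averaged `Q`, and below by -|B| because the weight is at least 1.
  have hφi : Integrable (fun ω => φ (X ω) / (‖X ω‖ ^ m + 1)) P := by
    refine (hQi'.norm.fun_add (integrable_const |B|)).mono'
      (Measurable.aestronglyMeasurable (by fun_prop)) (Eventually.of_forall fun ω => ?_)
    rw [Real.norm_eq_abs, abs_le]
    have h1 := hφle ω
    have h2 := le_abs_self (∫ u, Q (X ω, u) ∂(stdGaussian (EuclideanSpace ℝ (Fin d))))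
    rw [← Real.norm_eq_abs] at h2
    constructor
    · have h3 : -|B| ≤ φ (X ω) / (‖X ω‖ ^ m + 1) := by
        rw [le_div_iff₀ (hW0 _)]
        have := hφB _ (hXΩ ω)
        nlinarith [hW (X ω), abs_nonneg B, le_abs_self B]
      linarith [norm_nonneg (∫ u, Q (X ω, u) ∂(stdGaussian (EuclideanSpace ℝ (Fin d))))]
    · linarith [abs_nonneg B]
  have hpt : ∀ ω, ‖X' ω - y‖ ^ 2
      ≤ ‖X ω - y‖ ^ 2 - 2 * τ * Q (X ω, U ω) + τ ^ 2 * V (X ω, U ω) := fun ω => by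
    have h1 := (hstep ω).norm_sub_le hΩ (isProj_self hy)
    refine (pow_le_pow_left₀ (norm_nonneg _) h1 2).trans_eq ?_
    rw [show X ω - (τ / (‖X ω‖ ^ m + 1)) • gsDir f σ (X ω) (U ω) - y
      = (X ω - y) - (τ / (‖X ω‖ ^ m + 1)) • gsDir f σ (X ω) (U ω) by abel,
      norm_sub_sq_real, real_inner_smul_right, real_inner_comm, norm_smul, mul_pow,
      Real.norm_eq_abs, sq_abs]
    simp only [Q, V]
    have := (hW0 (X ω)).ne'
    field_simp
  have hsi : Integrable (fun ω => ‖X ω - y‖ ^ 2 - 2 * τ * Q (X ω, U ω)) P :=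
    hXy.sub (hQi.const_mul (2 * τ))
  have hbi := hsi.fun_add (hVi.const_mul (τ ^ 2))
  have hX'y : Integrable (fun ω => ‖X' ω - y‖ ^ 2) P := by
    refine hbi.mono' (Measurable.aestronglyMeasurable (by fun_prop))
      (Eventually.of_forall fun ω => ?_)
    rw [Real.norm_eq_abs, abs_of_nonneg (by positivity)]
    exact hpt ω
  refine ⟨?_, hφi, ?_⟩
  · have := integrable_norm_sub_sq (hX'.sub_const y) hX'y (-y)
    simpa using this
  · have h1 := integral_mono hX'y hbi hpt
    rw [integral_add hsi (hVi.const_mul (τ ^ 2)), integral_sub hXy (hQi.const_mul (2 * τ)), integral_const_mul, integral_const_mul] at h1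
    have h2 : ∫ ω, φ (X ω) / (‖X ω‖ ^ m + 1) ∂P ≤ ∫ ω, Q (X ω, U ω) ∂P := by
      rw [hQe]
      exact integral_mono hφi hQi' hφle
    have h3 := mul_le_mul_of_nonneg_left h2 (by positivity : 0 ≤ 2 * τ)
    have h4 := mul_le_mul_of_nonneg_left hVle (sq_nonneg τ)
    linarith

end Step

/-! ### Measurability and independence along the run. -/

section Run

variable {d : ℕ} {Ξ : Type*} [MeasurableSpace Ξ] {P : Measure Ξ}
  {f : EuclideanSpace ℝ (Fin d) → ℝ} {σ : ℝ} {m : ℕ} {Ω : Set (EuclideanSpace ℝ (Fin d))}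
  {τ : ℕ → ℝ} {x₀ : EuclideanSpace ℝ (Fin d)} {u x : ℕ → Ξ → EuclideanSpace ℝ (Fin d)}

lemma IsGSRun.mem (hrun : IsGSRun P f Ω m τ σ x₀ u x) (k : ℕ) (ω : Ξ) : x k ω ∈ Ω := by
  cases k with
  | zero => rw [hrun.init]; exact hrun.init_mem
  | succ k => exact (hrun.step k ω).1

/-- Each iterate is a measurable function of the previous random directions. -/
lemma IsGSRun.exists_measurable_eq (hrun : IsGSRun P f Ω m τ σ x₀ u x) (hΩ : IsClosed Ω)
    (hΩc : Convex ℝ Ω) (hf : Measurable f) (k : ℕ) :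
    ∃ g : (Finset.range k → EuclideanSpace ℝ (Fin d)) → EuclideanSpace ℝ (Fin d),
      Measurable g ∧ ∀ ω, x k ω = g (fun j => u j ω) := by
  -- Uniqueness and continuity of the projection turn the relation `IsProj` into a measurable
  -- recursion.
  obtain ⟨pr, hprc, hpr⟩ := exists_continuous_proj ⟨x₀, hrun.init_mem⟩ hΩ hΩc
  induction k with
  | zero => exact ⟨fun _ => x₀, measurable_const, hrun.init⟩
  | succ k ih =>
    obtain ⟨g, hg, hxg⟩ := ih
    have hprm := hprc.measurable
    let r : (Finset.range (k + 1) → EuclideanSpace ℝ (Fin d)) →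
        (Finset.range k → EuclideanSpace ℝ (Fin d)) := fun v j =>
      v ⟨j, Finset.range_subset_range.2 k.le_succ j.2⟩
    have hr : Measurable r := measurable_pi_lambda _ fun j => measurable_pi_apply _
    refine ⟨fun v => pr (g (r v) - (τ k / (‖g (r v)‖ ^ m + 1)) •
      gsDir f σ (g (r v)) (v ⟨k, Finset.self_mem_range_succ k⟩)), ?_, fun ω => ?_⟩
    · unfold gsDir; fun_prop
    · have := hpr _ _ (hrun.step k ω)
      rw [hxg ω] at this
      exact this

lemma IsGSRun.measurable (hrun : IsGSRun P f Ω m τ σ x₀ u x) (hΩ : IsClosed Ω)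
    (hΩc : Convex ℝ Ω) (hf : Measurable f) (k : ℕ) : Measurable (x k) := by
  obtain ⟨g, hg, hxg⟩ := hrun.exists_measurable_eq hΩ hΩc hf k
  rw [show x k = fun ω => g (fun j => u j ω) from funext hxg]
  exact hg.comp (measurable_pi_lambda _ fun j => hrun.measurable_dir j)

/-- `x k` depends only on the directions with index below k, a block disjoint from {k}. -/
lemma IsGSRun.indepFun (hrun : IsGSRun P f Ω m τ σ x₀ u x) (hΩ : IsClosed Ω)
    (hΩc : Convex ℝ Ω) (hf : Measurable f) (k : ℕ) : IndepFun (x k) (u k) P := by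
  obtain ⟨g, hg, hxg⟩ := hrun.exists_measurable_eq hΩ hΩc hf k
  have h := hrun.indep_dir.indepFun_finset (Finset.range k) {k} (by simp) hrun.measurable_dir
  have hev : Measurable (fun v : ({k} : Finset ℕ) → EuclideanSpace ℝ (Fin d) =>
      v ⟨k, Finset.mem_singleton_self k⟩) := measurable_pi_apply _
  have h2 := h.comp hg hev
  rw [show x k = fun ω => g (fun j => u j ω) from funext hxg]
  exact h2

end Run

/-! ### Fractional moments and removal of the weight. -/

section Moments

variable {Ξ : Type*} [MeasurableSpace Ξ] {P : Measure Ξ}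

lemma integral_mul_le_sqrt_mul_sqrt {g h : Ξ → ℝ} (hg0 : ∀ ω, 0 ≤ g ω) (hh0 : ∀ ω, 0 ≤ h ω)
    (hg : MemLp g 2 P) (hh : MemLp h 2 P) :
    ∫ ω, g ω * h ω ∂P ≤ √(∫ ω, g ω ^ 2 ∂P) * √(∫ ω, h ω ^ 2 ∂P) := by
  have := integral_mul_le_Lp_mul_Lq_of_nonneg (μ := P) Real.HolderConjugate.two_two
    (Eventually.of_forall hg0) (Eventually.of_forall hh0) (by simpa using hg) (by simpa using hh)
  simpa only [Real.rpow_two, ← Real.sqrt_eq_rpow] using this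

variable [IsProbabilityMeasure P]

lemma integral_rpow_le_rpow_integral {Z : Ξ → ℝ} {e : ℝ} (he : 0 ≤ e) (he1 : e ≤ 1)
    (hZ : ∀ ω, 0 ≤ Z ω) (hi : Integrable Z P) (hie : Integrable (fun ω => Z ω ^ e) P) :
    ∫ ω, Z ω ^ e ∂P ≤ (∫ ω, Z ω ∂P) ^ e :=
  (Real.concaveOn_rpow he he1).le_map_integral
    (Real.continuous_rpow_const he).continuousOn isClosed_Ici (Eventually.of_forall hZ) hi hie

/-- Removal of a polynomial weight from a fractional moment. -/
lemma integral_rpow_le_of_weighted {D N : Ξ → ℝ} {m : ℕ} (hm : m ≠ 0) {e : ℝ} (he : 0 < e) (he2 : 2 * e ≤ 1)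
    (hme : m * e ≤ 1) (hDm : Measurable D) (hNm : Measurable N) (hD : ∀ ω, 0 ≤ D ω)
    (hN : ∀ ω, 0 ≤ N ω) (hNi : Integrable (fun ω => N ω ^ 2) P)
    (hZi : Integrable (fun ω => D ω / (N ω ^ m + 1)) P) :
    Integrable (fun ω => D ω ^ e) P ∧
    ∫ ω, D ω ^ e ∂P ≤ (1 + √(∫ ω, N ω ^ 2 ∂P)) * (∫ ω, D ω / (N ω ^ m + 1) ∂P) ^ e := by
  set Z : Ξ → ℝ := fun ω => D ω / (N ω ^ m + 1)
  have hW : ∀ ω, 0 < N ω ^ m + 1 := fun ω => by have := hN ω; positivity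
  have hZ0 : ∀ ω, 0 ≤ Z ω := fun ω => div_nonneg (hD ω) (hW ω).le
  have hZm : Measurable Z := by fun_prop
  have hZe : ∀ c : ℝ, Measurable fun ω => Z ω ^ c := fun c => hZm.pow_const c
  -- Since N^m + 1 ≤ (1 + N)^m and m e ≤ 1, the e-th power of the weight is at most 1 + N.
  have hpt : ∀ ω, D ω ^ e ≤ Z ω ^ e * (1 + N ω) := fun ω => by
    have h0 := hN ω
    have h1 : D ω = Z ω * (N ω ^ m + 1) := (div_mul_cancel₀ _ (hW ω).ne').symm
    rw [h1, Real.mul_rpow (hZ0 ω) (hW ω).le]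
    refine mul_le_mul_of_nonneg_left ?_ (Real.rpow_nonneg (hZ0 ω) e)
    have h2 : N ω ^ m + 1 ≤ (1 + N ω) ^ m := by
      have := pow_add_pow_le h0 zero_le_one hm
      rwa [one_pow, add_comm (N ω)] at this
    calc (N ω ^ m + 1) ^ e ≤ ((1 + N ω) ^ m) ^ e := Real.rpow_le_rpow (hW ω).le h2 he.le
      _ = (1 + N ω) ^ (m * e) := by rw [Real.rpow_mul (by positivity), Real.rpow_natCast]
      _ ≤ (1 + N ω) ^ (1 : ℝ) := Real.rpow_le_rpow_of_exponent_le (by linarith) hme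
      _ = 1 + N ω := Real.rpow_one _
  have hZ2i : Integrable (fun ω => Z ω ^ (2 * e)) P := by
    refine ((integrable_const (1 : ℝ)).fun_add hZi).mono' (hZe _).aestronglyMeasurable
      (Eventually.of_forall fun ω => ?_)
    rw [Real.norm_eq_abs, abs_of_nonneg (Real.rpow_nonneg (hZ0 ω) _)]
    rcases le_total (Z ω) 1 with h | h
    · linarith [Real.rpow_le_one (hZ0 ω) h (by positivity : 0 ≤ 2 * e), hZ0 ω]
    · have := Real.rpow_le_rpow_of_exponent_le h he2
      rw [Real.rpow_one] at this
      linarith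
  have hsq : ∀ ω, (Z ω ^ e) ^ 2 = Z ω ^ (2 * e) := fun ω => by
    rw [← Real.rpow_natCast, ← Real.rpow_mul (hZ0 ω), mul_comm]; norm_num
  have hL1 : MemLp (fun ω => Z ω ^ e) 2 P := by
    rw [memLp_two_iff_integrable_sq (hZe e).aestronglyMeasurable]
    simpa only [hsq] using hZ2i
  have hLN : MemLp N 2 P := (memLp_two_iff_integrable_sq hNm.aestronglyMeasurable).2 hNi
  have hL2 : MemLp (fun ω => 1 + N ω) 2 P := by
    have h1 : MemLp (fun _ : Ξ => (1 : ℝ)) 2 P := memLp_const 1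
    exact h1.add hLN
  have hNi1 : Integrable N P := hLN.integrable (by norm_num)
  have hprod : Integrable (fun ω => Z ω ^ e * (1 + N ω)) P := hL1.integrable_mul hL2
  refine ⟨hprod.mono' (hDm.pow_const e).aestronglyMeasurable (Eventually.of_forall fun ω => ?_), ?_⟩
  · rw [Real.norm_eq_abs, abs_of_nonneg (Real.rpow_nonneg (hD ω) _)]
    exact hpt ω
  have hCS : ∫ ω, Z ω ^ e * (1 + N ω) ∂P
      ≤ √(∫ ω, Z ω ^ (2 * e) ∂P) * √(∫ ω, (1 + N ω) ^ 2 ∂P) := by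
    have := integral_mul_le_sqrt_mul_sqrt (fun ω => Real.rpow_nonneg (hZ0 ω) e)
      (fun ω => (by linarith [hN ω] : 0 ≤ 1 + N ω)) hL1 hL2
    simp_rw [hsq] at this
    exact this
  -- Here 2e ≤ 1 is needed: Cauchy-Schwarz doubled the exponent, and Jensen requires a concave
  -- power.
  have hJ : √(∫ ω, Z ω ^ (2 * e) ∂P) ≤ (∫ ω, Z ω ∂P) ^ e := by
    have h1 := integral_rpow_le_rpow_integral (by positivity) he2 hZ0 hZi hZ2i
    have h0 : 0 ≤ ∫ ω, Z ω ∂P := integral_nonneg hZ0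
    refine Real.sqrt_le_iff.2 ⟨Real.rpow_nonneg h0 _, h1.trans_eq ?_⟩
    rw [← Real.rpow_natCast, ← Real.rpow_mul h0, mul_comm]; norm_num
  have hM : √(∫ ω, (1 + N ω) ^ 2 ∂P) ≤ 1 + √(∫ ω, N ω ^ 2 ∂P) := by
    have hS0 : 0 ≤ ∫ ω, N ω ^ 2 ∂P := integral_nonneg fun ω => by positivity
    refine Real.sqrt_le_iff.2 ⟨by positivity, ?_⟩
    have h1 : ∫ ω, N ω ∂P ≤ √(∫ ω, N ω ^ 2 ∂P) :=
      Real.le_sqrt_of_sq_le (sq_integral_le_integral_sq hNi1 hNi)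
    have h2 : ∀ ω, (1 + N ω) ^ 2 = 1 + 2 * N ω + N ω ^ 2 := fun ω => by ring
    simp_rw [h2]
    rw [integral_add ((integrable_const _).fun_add (hNi1.const_mul 2)) hNi,
      integral_add (integrable_const _) (hNi1.const_mul 2), integral_const_mul]
    simp only [integral_const, probReal_univ, one_smul]
    nlinarith [Real.sq_sqrt hS0]
  calc ∫ ω, D ω ^ e ∂P ≤ ∫ ω, Z ω ^ e * (1 + N ω) ∂P :=
        integral_mono_of_nonneg (Eventually.of_forall fun ω => Real.rpow_nonneg (hD ω) e) hprod
          (Eventually.of_forall hpt)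
    _ ≤ _ := hCS
    _ ≤ (∫ ω, Z ω ∂P) ^ e * (1 + √(∫ ω, N ω ^ 2 ∂P)) := by
        gcongr
        exact Real.rpow_nonneg (integral_nonneg hZ0) _
    _ = _ := mul_comm _ _

/-- These are the constraints used in removing the weight; they hold because ⌈m/2⌉ is at least both
1 and m/2. -/
lemma expo_bounds {m : ℕ} (hm : 1 ≤ m) : 0 < expo m ∧ 2 * expo m ≤ 1 ∧ m * expo m ≤ 1 := by
  have h1 : (m : ℝ) / 2 ≤ (⌈(m : ℝ) / 2⌉₊ : ℝ) := Nat.le_ceil _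
  have h2 : (1 : ℝ) ≤ (⌈(m : ℝ) / 2⌉₊ : ℝ) := by
    have : (0 : ℝ) < m := by positivity
    exact_mod_cast Nat.ceil_pos.2 (by positivity : (0 : ℝ) < m / 2)
  unfold expo
  refine ⟨by positivity, ?_, ?_⟩
  · rw [mul_one_div, div_le_one (by positivity)]; linarith
  · rw [mul_one_div, div_le_one (by positivity)]; linarith

lemma scriptH_two_nonneg {d m : ℕ} {R₁ R₂ σ : ℝ} :
    0 ≤ scriptH d R₁ R₂ m σ 2 := by
  rw [scriptH, if_neg two_ne_zero]
  refine mul_nonneg (by positivity) (le_max_of_le_left ?_)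
  have := sq_nonneg R₁
  positivity

end Moments

end SPB

/-! ### The convergence bound. -/

theorem corollary4p7 {d : ℕ} {Ξ : Type*} [MeasurableSpace Ξ] (P : MeasureTheory.Measure Ξ)
    [MeasureTheory.IsProbabilityMeasure P]
    (f : EuclideanSpace ℝ (Fin d) → ℝ) (Ω : Set (EuclideanSpace ℝ (Fin d)))
    (hΩ_closed : IsClosed Ω) (hΩ_convex : Convex ℝ Ω)
    (R₁ R₂ : ℝ) (m : ℕ) (hm : 1 ≤ m) (hf : SPB.IsSPBWith f R₁ R₂ m)
    (hf_convex : ConvexOn ℝ Set.univ f) (hf_level : SPB.LevelBounded f)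
    (xs : EuclideanSpace ℝ (Fin d)) (hxs_mem : xs ∈ Ω) (hxs_min : ∀ y ∈ Ω, f xs ≤ f y)
    (γ : ℝ) (hγ : γ ∈ Set.Ioc (0 : ℝ) 1) (T : ℕ) (hT : 1 ≤ T)
    (τ : ℕ → ℝ) (hτ : ∀ k ≤ T, τ k = γ / √((T : ℝ) + 1))
    (σ : ℝ) (x₀ : EuclideanSpace ℝ (Fin d)) (u x : ℕ → Ξ → EuclideanSpace ℝ (Fin d))
    (hrun : SPB.IsGSRun P f Ω m τ σ x₀ u x) :
    BddAbove (SPB.levNorms f R₁ R₂ m σ xs) ∧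
    (∀ k ≤ T, MeasureTheory.Integrable (fun ω => (f (x k ω) - f xs) ^ SPB.expo m) P) ∧
    (Finset.range (T + 1)).inf' Finset.nonempty_range_add_one
        (fun k => ∫ ω, (f (x k ω) - f xs) ^ SPB.expo m ∂P) ≤
      (1 + √(SPB.Mbd f R₁ R₂ m σ γ x₀ xs)) *
        (2 * SPB.Cbd R₁ R₂ m σ γ x₀ xs * (T : ℝ) ^ (-(1 / 2) : ℝ) +
          2 * SPB.scriptM R₁ R₂ m σ xs * σ) ^ SPB.expo m := by
  obtain ⟨he, he2, hme⟩ := SPB.expo_bounds hm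
  have hσ := hrun.sigma_pos
  have hfm := hf.measurable
  have hH : 0 ≤ SPB.scriptH d R₁ R₂ m σ 2 := SPB.scriptH_two_nonneg
  have hM := SPB.scriptM_nonneg (m := m) hf.R₁_nonneg hf.R₂_pos.le hσ.le xs
  set H := SPB.scriptH d R₁ R₂ m σ 2 with hHdef
  set M := SPB.scriptM R₁ R₂ m σ xs with hMdef
  have hT0 : (0 : ℝ) < (T : ℝ) + 1 := by positivity
  set t : ℝ := γ / √((T : ℝ) + 1) with ht
  have ht0 : 0 < t := div_pos hγ.1 (Real.sqrt_pos.2 hT0)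
  have htsq : ((T : ℝ) + 1) * t ^ 2 = γ ^ 2 := by
    rw [ht, div_pow, Real.sq_sqrt hT0.le]; field_simp
  have hxm := fun k => hrun.measurable hΩ_closed hΩ_convex hfm k
  have hxi0 : MeasureTheory.Integrable (fun ω => ‖x 0 ω‖ ^ 2) P := by
    simp only [hrun.init]; exact MeasureTheory.integrable_const _
  have hstep := fun (k : ℕ) (hk : MeasureTheory.Integrable (fun ω => ‖x k ω‖ ^ 2) P)
      (y : EuclideanSpace ℝ (Fin d)) (hy : y ∈ Ω) (φ : EuclideanSpace ℝ (Fin d) → ℝ)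
      (hφm : Measurable φ) (B : ℝ) (hφB : ∀ x ∈ Ω, -B ≤ φ x)
      (hφ : ∀ x ∈ Ω, φ x ≤ SPB.gaussSmooth f σ x - SPB.gaussSmooth f σ y) =>
    hf.integral_norm_sq_step_le hf_convex hm hσ hΩ_convex (hxm k) (hrun.measurable_dir k)
      (hxm (k + 1)) (hrun.indepFun hΩ_closed hΩ_convex hfm k) (hrun.law_dir k) (hrun.mem k) hk
      (hrun.tau_mem k).1.le (hrun.step k) hy hφm hφB hφ
  -- With x* as reference point, f_σ - f_σ(x*) could be negative on Ω and second moments could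
  -- drift; with z, φ = 0 is admissible.
  obtain ⟨z, hz, hzmin, hzlev⟩ :=
    hf.exists_isMinOn_gaussSmooth hf_convex hf_level hm hσ hΩ_closed hxs_mem
  have hxi : ∀ k, MeasureTheory.Integrable (fun ω => ‖x k ω‖ ^ 2) P := fun k => by
    induction k with
    | zero => exact hxi0
    | succ k ih =>
      exact (hstep k ih z hz (fun _ => 0) measurable_const 0 (by simp)
        fun y hy => by simpa using hzmin y hy).1
  have hzbound : ∀ k ≤ T + 1, ∫ ω, ‖x k ω - z‖ ^ 2 ∂P ≤ ‖x₀ - z‖ ^ 2 + k * (t ^ 2 * H) := by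
    intro k
    induction k with
    | zero => intro _; simp [hrun.init]
    | succ k ih =>
      intro hk
      have h1 := (hstep k (hxi k) z hz (fun _ => 0) measurable_const 0 (by simp)
        fun y hy => by simpa using hzmin y hy).2.2
      rw [hτ k (by omega)] at h1
      simp only [zero_div, MeasureTheory.integral_zero, mul_zero, sub_zero] at h1
      have h2 := ih (by omega)
      push_cast
      linarith
  -- Applying (a + b)² ≤ 2a² + 2b² to x_k = (x_k - z) + z and to x₀ - z yields the constants 4, 6 =
  -- 4 + 2 and 2.
  have hMbd : ∀ k ≤ T, ∫ ω, ‖x k ω‖ ^ 2 ∂P ≤ SPB.Mbd f R₁ R₂ m σ γ x₀ xs := by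
    intro k hk
    have h1 := hzbound k (by omega)
    have hi := SPB.integrable_norm_sub_sq (hxm k) (hxi k) z
    have h2 : ∫ ω, ‖x k ω‖ ^ 2 ∂P ≤ ∫ ω, (2 * ‖x k ω - z‖ ^ 2 + 2 * ‖z‖ ^ 2) ∂P := by
      refine MeasureTheory.integral_mono (hxi k)
        ((hi.const_mul 2).add (MeasureTheory.integrable_const _)) fun ω => ?_
      have := norm_add_le (x k ω - z) z
      rw [sub_add_cancel] at this
      simp only
      nlinarith [sq_nonneg (‖x k ω - z‖ - ‖z‖), norm_nonneg (x k ω)]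
    rw [MeasureTheory.integral_add (hi.const_mul 2) (MeasureTheory.integrable_const _),
      MeasureTheory.integral_const_mul] at h2
    simp only [MeasureTheory.integral_const, MeasureTheory.probReal_univ, one_smul] at h2
    have h3 : ‖x₀ - z‖ ^ 2 ≤ 2 * ‖x₀‖ ^ 2 + 2 * ‖z‖ ^ 2 := by
      have := norm_sub_le x₀ z
      nlinarith [sq_nonneg (‖x₀‖ - ‖z‖), norm_nonneg (x₀ - z)]
    have h4 : ‖z‖ ^ 2 ≤ SPB.Clev f R₁ R₂ m σ xs ^ 2 :=
      pow_le_pow_left₀ (norm_nonneg _) hzlev 2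
    have h5 : (k : ℝ) * (t ^ 2 * H) ≤ γ ^ 2 * H := by
      rw [← htsq, mul_assoc]
      have : (k : ℝ) ≤ (T : ℝ) + 1 := by exact_mod_cast (by omega : k ≤ T + 1)
      gcongr
    unfold SPB.Mbd
    linarith
  set A : ℕ → ℝ := fun k => ∫ ω, (f (x k ω) - f xs) / (‖x k ω‖ ^ m + 1) ∂P with hA
  have hWi : ∀ k, MeasureTheory.Integrable (fun ω => (M * σ) / (‖x k ω‖ ^ m + 1)) P := fun k => by
    have := hxm k
    refine (MeasureTheory.integrable_const (M * σ)).mono'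
      (Measurable.aestronglyMeasurable (by fun_prop)) (Filter.Eventually.of_forall fun ω => ?_)
    rw [Real.norm_eq_abs, abs_of_nonneg (by positivity)]
    exact div_le_self (by positivity) (le_add_of_nonneg_left (by positivity))
  have hAstep : ∀ k, MeasureTheory.Integrable
        (fun ω => (f (x k ω) - f xs) / (‖x k ω‖ ^ m + 1)) P ∧
      ∫ ω, ‖x (k + 1) ω - xs‖ ^ 2 ∂P ≤ ∫ ω, ‖x k ω - xs‖ ^ 2 ∂P
        - 2 * τ k * (A k - M * σ) + τ k ^ 2 * H := fun k => by
    -- This φ lies below f_σ - f_σ(x*) because f ≤ f_σ and f_σ(x*) ≤ f(x*) + 𝓜σ; minimality of x*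
    -- gives φ ≥ -𝓜σ on Ω.
    obtain ⟨-, h1, h2⟩ := hstep k (hxi k) xs hxs_mem (fun y => f y - f xs - M * σ) (by fun_prop)
      (M * σ) (fun y hy => by linarith [hxs_min y hy]) fun y hy => by
        have e1 := hf.le_gaussSmooth hf_convex hσ y
        have e2 := hf.gaussSmooth_le hf_convex hm hσ xs
        rw [← hMdef] at e2
        linarith
    have h3 : MeasureTheory.Integrable
        (fun ω => (f (x k ω) - f xs) / (‖x k ω‖ ^ m + 1)) P := by
      refine (h1.add (hWi k)).congr (Filter.Eventually.of_forall fun ω => ?_)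
      simp only [Pi.add_apply]; rw [← add_div, sub_add_cancel]
    refine ⟨h3, h2.trans ?_⟩
    have h4 : A k - M * σ ≤ ∫ ω, (f (x k ω) - f xs - M * σ) / (‖x k ω‖ ^ m + 1) ∂P := by
      have : A k - ∫ _, M * σ ∂P
          ≤ ∫ ω, (f (x k ω) - f xs - M * σ) / (‖x k ω‖ ^ m + 1) ∂P := by
        rw [hA, ← MeasureTheory.integral_sub h3 (MeasureTheory.integrable_const _)]
        refine MeasureTheory.integral_mono (h3.sub (MeasureTheory.integrable_const _)) h1
          fun ω => ?_
        simp only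
        rw [sub_div (f (x k ω) - f xs)]
        have : M * σ / (‖x k ω‖ ^ m + 1) ≤ M * σ :=
          div_le_self (by positivity) (le_add_of_nonneg_left (by positivity))
        linarith
      simpa using this
    have := mul_le_mul_of_nonneg_left h4 (by linarith [(hrun.tau_mem k).1] : 0 ≤ 2 * τ k)
    linarith
  have hsum : ∀ n ≤ T + 1, ∑ k ∈ Finset.range n, 2 * t * (A k - M * σ)
      ≤ ‖x₀ - xs‖ ^ 2 + n * (t ^ 2 * H) - ∫ ω, ‖x n ω - xs‖ ^ 2 ∂P := by
    intro n
    induction n with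
    | zero => intro _; simp [hrun.init]
    | succ n ih =>
      intro hn
      have h1 := (hAstep n).2
      rw [hτ n (by omega)] at h1
      have h2 := ih (by omega)
      rw [Finset.sum_range_succ]
      push_cast
      linarith
  -- Some term of the telescoped sum is at most the average over T + 1 steps, and (T + 1)t² = γ².
  obtain ⟨k, hk, hAk⟩ : ∃ k ∈ Finset.range (T + 1), 2 * t * (A k - M * σ)
      ≤ (‖x₀ - xs‖ ^ 2 + H * γ ^ 2) / ((T : ℝ) + 1) := by
    refine Finset.exists_le_of_sum_le Finset.nonempty_range_add_one ?_
    have h1 := hsum (T + 1) le_rfl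
    have h2 : 0 ≤ ∫ ω, ‖x (T + 1) ω - xs‖ ^ 2 ∂P :=
      MeasureTheory.integral_nonneg fun ω => by positivity
    rw [Finset.sum_const, Finset.card_range, nsmul_eq_mul]
    push_cast at h1 ⊢
    rw [mul_div_cancel₀ _ hT0.ne', ← htsq]
    linarith
  have hD0 : ∀ k ω, 0 ≤ f (x k ω) - f xs := fun k ω => sub_nonneg.2 (hxs_min _ (hrun.mem k ω))
  have hmain := fun k => by
    have hxk := hxm k
    exact SPB.integral_rpow_le_of_weighted (P := P) (D := fun ω => f (x k ω) - f xs)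
      (N := fun ω => ‖x k ω‖) (by omega) he he2 hme (by fun_prop) (by fun_prop) (hD0 k)
      (fun ω => norm_nonneg _) (hxi k) (hAstep k).1
  refine ⟨SPB.bddAbove_levNorms hf_level xs, fun k _ => (hmain k).1, ?_⟩
  have hkT : k ≤ T := by simpa [Nat.lt_succ_iff] using hk
  refine (Finset.inf'_le _ hk).trans ((hmain k).2.trans ?_)
  have hA0 : 0 ≤ A k := MeasureTheory.integral_nonneg fun ω =>
    div_nonneg (hD0 k ω) (by positivity)
  have hC0 : 0 ≤ SPB.Cbd R₁ R₂ m σ γ x₀ xs := by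
    have := hγ.1
    unfold SPB.Cbd
    rw [← hHdef]
    positivity
  have hTp : (0 : ℝ) < T := by exact_mod_cast hT
  -- The argument gives C_bd (T + 1)^(-1/2) + 𝓜σ; the factors 2 and the T in place of T + 1 are
  -- slack.
  have hAC : A k ≤ 2 * SPB.Cbd R₁ R₂ m σ γ x₀ xs * (T : ℝ) ^ (-(1 / 2) : ℝ) + 2 * M * σ := by
    have h1 : A k - M * σ ≤ SPB.Cbd R₁ R₂ m σ γ x₀ xs * (√((T : ℝ) + 1))⁻¹ := by
      have e : SPB.Cbd R₁ R₂ m σ γ x₀ xs * (√((T : ℝ) + 1))⁻¹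
          = (‖x₀ - xs‖ ^ 2 + H * γ ^ 2) / ((T : ℝ) + 1) / (2 * t) := by
        have hs : √((T : ℝ) + 1) ≠ 0 := (Real.sqrt_pos.2 hT0).ne'
        have hs2 : ((T : ℝ) + 1) = √((T : ℝ) + 1) ^ 2 := (Real.sq_sqrt hT0.le).symm
        have := hγ.1.ne'
        rw [SPB.Cbd, ← hHdef, ht]
        nth_rewrite 2 [hs2]
        field_simp
      rw [e, le_div_iff₀ (by positivity)]
      linarith
    have h2 : (√((T : ℝ) + 1))⁻¹ ≤ (T : ℝ) ^ (-(1 / 2) : ℝ) := by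
      rw [Real.rpow_neg hTp.le, ← Real.sqrt_eq_rpow]
      exact inv_anti₀ (Real.sqrt_pos.2 hTp) (Real.sqrt_le_sqrt (by linarith))
    have h3 := mul_le_mul_of_nonneg_left h2 hC0
    have h4 : 0 ≤ SPB.Cbd R₁ R₂ m σ γ x₀ xs * (T : ℝ) ^ (-(1 / 2) : ℝ) := by positivity
    have h5 : 0 ≤ M * σ := by positivity
    linarith
  have hMk := hMbd k hkT
  gcongr
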